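/- A category is called semi-abelian when it is pointed, Barr exact, Bourn-protomodular and has binary coproducts. For an object $Y$ let $\mathsf{Pt}_Y(\mathcal X)$ be the pointed category of split epimorphisms $f\colon X\to Y$ with a chosen splitting $s$, with the morphisms over $Y$ compatible with the splittings. Protomodularity means that all change-of-base functors $w^*\colon \mathsf{Pt}_Y(\mathcal X)\to\mathsf{Pt}_Z(\mathcal X)$, given by pulling back along $w\colon Z\to Y$, reflect isomorphisms. A semi-abelian category $\mathcal X$ is *strongly protomodular* when all these functors moreover reflect normal monomorphisms (a normal monomorphism being a kernel of some morphism). It satisfies *(WNH)* when, for every normal subobject $K$ of an object $X$, the Higgins commutator $[K,K]$ is normal in $X$; here, for subobjects $k\colon K\to X$ and $l\colon L\to X$, the Higgins commutator $[K,L]$ is the image in $X$ of the composite of the inclusion $\operatorname{Ker}(K+L\to K\times L)\to K+L$ with the morphism $K+L\to X$ induced by $k$ and $l$. An *arithmetical* category is a Barr exact Mal'tsev category (every internal reflexive relation is an equivalence relation) in which the equivalence relations on each object form a distributive lattice. **Proposition.** For semi-abelian categories, the conditions (WNH) and strong protomodularity are independent: neither implies the other. More precisely: 1. Let $\mathcal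 X$ be the variety of abelian groups $(A,0,+,-)$ equipped with a binary operation $\cdot$ satisfying the identities $x+x=0$, $x\cdot x=x$, $x\cdot y=y\cdot x$ and $x\cdot 0=0$, with all maps preserving the operations as morphisms. Then $\mathcal X$ is semi-abelian and arithmetical, and satisfies (WNH), but is not strongly protomodular. 2. The category of non-associative (that is, not necessarily associative or unital) rings is semi-abelian and strongly protomodular, but does not satisfy (WNH). -/

import Mathlib

open CategoryTheory CategoryTheory.Limits

universe v u

namespace SemiAb

section Categorical

variable {C : Type u} [Category.{v} C]

/-- A morphism is a *normal monomorphism* when it is a kernel of some morphism. -/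
def IsNormalMono [HasZeroMorphisms C] {X Y : C} (m : X ⟶ Y) : Prop :=
  Nonempty (NormalMono m)

/-- A *point over* `Y`: a split epimorphism `f : X ⟶ Y` with a chosen splitting `s`. -/
structure Pt (Y : C) where
  X : C
  f : X ⟶ Y
  s : Y ⟶ X
  sf : s ≫ f = 𝟙 Y

/-- Morphisms in the fibre `Pt Y` (the identity on the base `Y`). -/
@[ext]
structure Pt.Hom {Y : C} (P Q : Pt Y) where
  hom : P.X ⟶ Q.X
  comm_f : hom ≫ Q.f = P.f
  comm_s : P.s ≫ hom = Q.s

instance Pt.category (Y : C) : Category (Pt Y) where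
  Hom P Q := Pt.Hom P Q
  id P := ⟨𝟙 P.X, Category.id_comp _, Category.comp_id _⟩
  comp {P Q R} g h := ⟨g.hom ≫ h.hom, by rw [Category.assoc, h.comm_f, g.comm_f],
    by rw [← Category.assoc, g.comm_s, h.comm_s]⟩
  id_comp g := Pt.Hom.ext (Category.id_comp g.hom)
  comp_id g := Pt.Hom.ext (Category.comp_id g.hom)
  assoc g h k := Pt.Hom.ext (Category.assoc g.hom h.hom k.hom)

@[ext]
theorem Pt.hom_ext {Y : C} {P Q : Pt Y} {g h : P ⟶ Q} (e : g.hom = h.hom) : g = h :=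
  Pt.Hom.ext e

@[simp]
theorem Pt.id_hom {Y : C} (P : Pt Y) : Pt.Hom.hom (𝟙 P) = 𝟙 P.X := rfl

@[simp]
theorem Pt.comp_hom {Y : C} {P Q R : Pt Y} (g : P ⟶ Q) (h : Q ⟶ R) :
    (g ≫ h).hom = g.hom ≫ h.hom := rfl

/-- `Pt Y` is pointed: the zero morphism `P ⟶ Q` is `P ⟶ Y ⟶ Q`, through the zero object
`(𝟙 Y, 𝟙 Y)`. -/
instance Pt.hasZeroMorphisms (Y : C) : HasZeroMorphisms (Pt Y) where
  zero P Q := ⟨⟨P.f ≫ Q.s, by rw [Category.assoc, Q.sf, Category.comp_id],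
    by rw [← Category.assoc, P.sf, Category.id_comp]⟩⟩
  comp_zero {P Q} g R := Pt.Hom.ext (by
    change g.hom ≫ Q.f ≫ R.s = P.f ≫ R.s
    rw [← Category.assoc, g.comm_f])
  zero_comp P {Q R} g := Pt.Hom.ext (by
    change (P.f ≫ Q.s) ≫ g.hom = P.f ≫ R.s
    rw [Category.assoc, g.comm_s])

/-- The pullback of a point over `Y` along `w : Z ⟶ Y`. -/
noncomputable abbrev Pt.pull [HasPullbacks C] {Z Y : C} (w : Z ⟶ Y) (P : Pt Y) : Pt Z where
  X := pullback P.f w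
  f := pullback.snd P.f w
  s := pullback.lift (w ≫ P.s) (𝟙 Z)
    (by rw [Category.assoc, P.sf, Category.comp_id, Category.id_comp])
  sf := pullback.lift_snd _ _ _

/-- The morphism `P ×_Y Z ⟶ Q ×_Y Z` induced by a morphism of points over `Y`. -/
noncomputable abbrev Pt.pullHom [HasPullbacks C] {Z Y : C} (w : Z ⟶ Y) {P Q : Pt Y} (g : P ⟶ Q) :
    pullback P.f w ⟶ pullback Q.f w :=
  pullback.lift (pullback.fst P.f w ≫ g.hom) (pullback.snd P.f w)
    (by rw [Category.assoc, g.comm_f, pullback.condition])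

theorem Pt.lift_pullHom [HasPullbacks C] {Z Y : C} (w : Z ⟶ Y) {P Q : Pt Y} (g : P ⟶ Q) :
    (P.pull w).s ≫ Pt.pullHom w g = (Q.pull w).s := by
  apply pullback.hom_ext
  · rw [Category.assoc, pullback.lift_fst, pullback.lift_fst_assoc, Category.assoc, g.comm_s,
      pullback.lift_fst]
  · rw [Category.assoc, pullback.lift_snd, pullback.lift_snd, pullback.lift_snd]

/-- The change-of-base functor `w^* : Pt Y ⥤ Pt Z` along `w : Z ⟶ Y`, given by pulling back. -/
noncomputable def Pt.baseChange [HasPullbacks C] {Z Y : C} (w : Z ⟶ Y) : Pt Y ⥤ Pt Z where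
  obj P := P.pull w
  map g := ⟨Pt.pullHom w g, pullback.lift_snd _ _ _, Pt.lift_pullHom w g⟩
  map_id P := by
    apply Pt.Hom.ext
    apply pullback.hom_ext
    · exact (pullback.lift_fst _ _ _).trans
        ((Category.comp_id _).trans (Category.id_comp _).symm)
    · exact (pullback.lift_snd _ _ _).trans (Category.id_comp _).symm
  map_comp {P Q R} g h := by
    apply Pt.Hom.ext
    change Pt.pullHom w (g ≫ h) = Pt.pullHom w g ≫ Pt.pullHom w h
    apply pullback.hom_ext
    · rw [pullback.lift_fst, Category.assoc, pullback.lift_fst, pullback.lift_fst_assoc,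
        Category.assoc, Pt.comp_hom]
    · rw [pullback.lift_snd, Category.assoc, pullback.lift_snd, pullback.lift_snd]

end Categorical

/-- A *Barr exact* category: a regular category in which every internal equivalence relation is
effective. -/
class BarrExact (C : Type u) [Category.{v} C] : Prop extends Regular C where
  effective : ∀ {R X : C} (p₁ p₂ : R ⟶ X),
    IsEquivalenceRelation p₁ p₂ → IsEffectiveEquivalenceRelation p₁ p₂

/-- A (Bourn-)*protomodular* category: every change-of-base functor between categories of points
is conservative. -/
def Protomodular (C : Type u) [Category.{v} C] [HasPullbacks C] : Prop :=
  ∀ {Z Y : C} (w : Z ⟶ Y), (Pt.baseChange w).ReflectsIsomorphisms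

/-- A *semi-abelian* category: pointed, Barr exact, protomodular, with binary coproducts. -/
class SemiAbelian (C : Type u) [Category.{v} C] [HasZeroMorphisms C] : Prop
    extends BarrExact C where
  hasZeroObject : HasZeroObject C
  hasBinaryCoproducts : HasBinaryCoproducts C
  protomodular : Protomodular C

attribute [instance] SemiAbelian.hasZeroObject SemiAbelian.hasBinaryCoproducts

/-- A *strongly protomodular* category: protomodular, and every change-of-base functor between
categories of points reflects normal monomorphisms. -/
def StronglyProtomodular (C : Type u) [Category.{v} C] [HasPullbacks C] : Prop :=
  Protomodular C ∧
    ∀ {Z Y : C} (w : Z ⟶ Y) {P Q : Pt Y} (m : P ⟶ Q),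
      IsNormalMono ((Pt.baseChange w).map m) → IsNormalMono m

section Commutator

variable {C : Type u} [Category.{v} C] [HasZeroMorphisms C] [SemiAbelian C]

/-- The canonical comparison `K + L ⟶ K × L`. -/
noncomputable def coprodToProd (K L : C) : K ⨿ L ⟶ K ⨯ L :=
  prod.lift (coprod.desc (𝟙 K) 0) (coprod.desc 0 (𝟙 L))

/-- The co-smash product `K ⋄ L`, the kernel of `K + L ⟶ K × L`. -/
noncomputable def coSmash (K L : C) : C := kernel (coprodToProd K L)

/-- The inclusion of `K ⋄ L` in `K + L`. -/
noncomputable def coSmashι (K L : C) : coSmash K L ⟶ K ⨿ L := kernel.ι (coprodToProd K L)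

/-- The *Higgins commutator* `[K, L]` of two subobjects of `X`: the image of
`K ⋄ L ⟶ K + L ⟶ X`. -/
noncomputable def higgins {X : C} (K L : Subobject X) : Subobject X :=
  imageSubobject (coSmashι (K : C) (L : C) ≫ coprod.desc K.arrow L.arrow)

end Commutator

/-- Condition (WNH): for every normal subobject `K` of `X`, the Higgins commutator `[K, K]` is
normal in `X`. -/
def WNH (C : Type u) [Category.{v} C] [HasZeroMorphisms C] [SemiAbelian C] : Prop :=
  ∀ {X : C} (K : Subobject X), IsNormalMono K.arrow → IsNormalMono (higgins K K).arrow

/-- The poset of (internal) equivalence relations on `X`, as subobjects of `X × X`. -/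
abbrev EqRel {C : Type u} [Category.{v} C] [HasFiniteLimits C] (X : C) :=
  {R : Subobject (X ⨯ X) // IsEquivalenceRelation (R.arrow ≫ prod.fst) (R.arrow ≫ prod.snd)}

/-- An *arithmetical* category: Barr exact, Mal'tsev (every internal reflexive relation is an
equivalence relation), and such that for every object the poset of equivalence relations on it is
a distributive lattice. -/
class Arithmetical (C : Type u) [Category.{v} C] : Prop extends BarrExact C where
  maltsev : ∀ {R X : C} (p₁ p₂ : R ⟶ X),
    Nonempty (ReflexiveRelation p₁ p₂) → IsEquivalenceRelation p₁ p₂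
  distrib : ∀ X : C, ∃ L : DistribLattice (EqRel X),
    ∀ R S : EqRel X, L.le R S ↔ R ≤ S

/-! ### Abelian groups of exponent two with an idempotent commutative product -/

/-- An abelian group with a binary operation such that `x + x = 0`, `x * x = x`, `x * y = y * x`
and `x * 0 = 0`. (No distributivity or associativity of `*` is required.) -/
class ExpTwoAlgebra (A : Type u) extends AddCommGroup A, Mul A where
  add_self : ∀ x : A, x + x = 0
  mul_self : ∀ x : A, x * x = x
  mul_comm : ∀ x y : A, x * y = y * x
  mul_zero : ∀ x : A, x * 0 = 0

/-- The variety of all `ExpTwoAlgebra`s. -/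
structure ExpTwoAlgCat : Type (u + 1) where
  carrier : Type u
  [str : ExpTwoAlgebra carrier]

attribute [instance] ExpTwoAlgCat.str

/-- Morphisms are the maps preserving the operations. -/
@[ext]
structure ExpTwoAlgCat.Hom (A B : ExpTwoAlgCat.{u}) where
  toFun : A.carrier → B.carrier
  map_zero : toFun 0 = 0
  map_neg : ∀ x, toFun (-x) = -toFun x
  map_add : ∀ x y, toFun (x + y) = toFun x + toFun y
  map_mul : ∀ x y, toFun (x * y) = toFun x * toFun y

instance : Category ExpTwoAlgCat.{u} where
  Hom A B := ExpTwoAlgCat.Hom A B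
  id A := ⟨fun x => x, rfl, fun _ => rfl, fun _ _ => rfl, fun _ _ => rfl⟩
  comp f g := ⟨fun x => g.toFun (f.toFun x), by rw [f.map_zero, g.map_zero],
    fun x => by rw [f.map_neg, g.map_neg], fun x y => by rw [f.map_add, g.map_add],
    fun x y => by rw [f.map_mul, g.map_mul]⟩

instance : HasZeroMorphisms ExpTwoAlgCat.{u} where
  zero _ _ := ⟨⟨fun _ => 0, rfl, fun _ => neg_zero.symm, fun _ _ => (add_zero 0).symm,
    fun _ _ => (ExpTwoAlgebra.mul_zero 0).symm⟩⟩
  comp_zero _ _ := rfl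
  zero_comp _ {_ _} g := ExpTwoAlgCat.Hom.ext (funext fun _ => g.map_zero)

/-! ### Non-associative rings -/

/-- The category of non-associative (that is, not necessarily associative or unital) rings. -/
structure NonAssocRngCat : Type (u + 1) where
  carrier : Type u
  [str : NonUnitalNonAssocRing carrier]

attribute [instance] NonAssocRngCat.str

/-- Morphisms are the ring homomorphisms, in the non-unital sense. -/
@[ext]
structure NonAssocRngCat.Hom (A B : NonAssocRngCat.{u}) where
  hom : A.carrier →ₙ+* B.carrier

instance : Category NonAssocRngCat.{u} where
  Hom A B := NonAssocRngCat.Hom A B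
  id A := ⟨NonUnitalRingHom.id A.carrier⟩
  comp f g := ⟨g.hom.comp f.hom⟩

instance : HasZeroMorphisms NonAssocRngCat.{u} where
  zero _ _ := ⟨⟨0⟩⟩
  comp_zero _ _ := rfl
  zero_comp _ {_ _} g := NonAssocRngCat.Hom.ext (NonUnitalRingHom.ext fun _ => map_zero g.hom)

end SemiAb

/-!
Both categories are varieties of abelian groups with an additional binary operation `*` such that
`0 * 0 = 0`. The class `AbMagmaVariety` records what is used about such a variety: its morphisms are
all the homomorphisms, and up to isomorphism it contains the algebras whose points are separated by
homomorphisms to its objects, and the quotients of its objects. In this setting pullbacks,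
monomorphisms, regular epimorphisms and reflexive relations have the expected description on
elements. A reflexive relation is a congruence because `(x, y) ↦ x - y` detects it
(`exists_ideal_of_reflexive`), congruences are the kernel pairs of quotients by ideals, the
coproduct of `A` and `B` consists of terms with variables in `A` and `B` modulo equality of all
their values (`exists_coproduct`), and protomodularity holds because an element `x` of a point
`(f, s)` over `Y` is the sum of `x - s (f x)`, which is in the kernel of `f`, and `s (f x)`. Hence
every such variety is semi-abelian (`semiAbelian`).

A morphism `m : P ⟶ Q` of points over `Y` is a normal monomorphism exactly when it is injective and
maps the kernel of `P ⟶ Y` onto an ideal of the total algebra of `Q`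
(`injective_and_exists_ideal_of_isNormalMono`, `isNormalMono_of_ideal`). Base change preserves
kernels, so if a base change of `m` is a normal monomorphism, then the image `N` of the kernel of
`P ⟶ Y` is an ideal of the kernel of `Q ⟶ Y`. The question is whether `N` is an ideal of `Q`.

When `*` is distributive, `N` absorbs products with the kernel, in which it is an ideal, and
products with `Y`, because `N + Y` is the image of `m`; so `N` is an ideal of `Q`, and non-associative rings are
strongly protomodular (`stronglyProtomodular_of_distrib`). They do not satisfy (WNH): for the ideal
`K = {(a, b, 0)}` of `ℤ³` with product `(a, b, c) * (a', b', c') = (c b', a a', 0)`, the commutator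
`[K, K]` contains `(0, 1, 0)` but no element with a non-zero first coordinate, whereas
`(0, 0, 1) * (0, 1, 0) = (1, 0, 0)`.

When `x * x = x` and products with `0` vanish, `[K, K] = K` because `x = x * x`
(`wnh_of_mul_self`), and the ideals form a distributive lattice because an element `x = n + m` of
`L ∩ (N + M)` is the sum of `x * n`, which is in `L ∩ N`, and `x - x * n`, which is in `L ∩ M`
(`arithmetical_of_mul_self`). Strong protomodularity fails for `𝔽₂³` with the product
`(a, b, c) * (a', b', c') = (a a', b b' + a b' c' + a' b c, c c')`, as a point over the last
coordinate: on the kernel `c = 0` the product is coordinatewise, so that `b = c = 0` is an ideal of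
the kernel, but it is not an ideal of the whole algebra.
-/

namespace SemiAb

/-! ### Abelian groups with a binary operation -/

/-- An abelian group with a binary operation `*` satisfying `0 * 0 = 0`; no compatibility of `*`
with the addition is required. -/
class AbMagma (A : Type u) extends AddCommGroup A, Mul A where
  zero_mul_zero : (0 : A) * 0 = 0

/-- The maps preserving the addition and the binary operation. -/
structure AbMagmaHom (A B : Type u) [AbMagma A] [AbMagma B] extends A →+ B, A →ₙ* B

namespace AbMagmaHom

variable {A B D : Type u} [AbMagma A] [AbMagma B] [AbMagma D]

instance : FunLike (AbMagmaHom A B) A B where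
  coe f := f.toFun
  coe_injective f g h := by
    obtain ⟨⟨⟨_, _⟩, _⟩, _⟩ := f
    obtain ⟨⟨⟨_, _⟩, _⟩, _⟩ := g
    congr

instance : AddMonoidHomClass (AbMagmaHom A B) A B where
  map_add f := f.map_add'
  map_zero f := f.map_zero'

instance : MulHomClass (AbMagmaHom A B) A B where
  map_mul f := f.map_mul'

/-- A map preserving `+` and `*`, as a homomorphism. -/
def mk' (f : A → B) (hadd : ∀ x y, f (x + y) = f x + f y) (hmul : ∀ x y, f (x * y) = f x * f y) :
    AbMagmaHom A B where
  __ := AddMonoidHom.mk' f hadd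
  map_mul' := hmul

@[simp] theorem mk'_apply (f : A → B) (hadd hmul) (x : A) :
    (mk' f hadd hmul : AbMagmaHom A B) x = f x := rfl

/-- Composition of homomorphisms. -/
def comp (g : AbMagmaHom B D) (f : AbMagmaHom A B) : AbMagmaHom A D :=
  mk' (fun x => g (f x)) (by simp) (by simp)

@[simp] theorem comp_apply (g : AbMagmaHom B D) (f : AbMagmaHom A B) (x : A) :
    g.comp f x = g (f x) := rfl

end AbMagmaHom

instance {A B : Type u} [AbMagma A] [AbMagma B] : AbMagma (A × B) where
  zero_mul_zero := Prod.ext AbMagma.zero_mul_zero AbMagma.zero_mul_zero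

/-- An ideal: the class of `0` of a congruence. -/
@[ext]
structure AbIdeal (A : Type u) [AbMagma A] extends AddSubgroup A where
  mul_sub_mul_mem {a a' b b' : A} : a - a' ∈ carrier → b - b' ∈ carrier →
    a * b - a' * b' ∈ carrier

theorem AbIdeal.mul_sub_mul_zero_mem {A : Type u} [AbMagma A] (N : AbIdeal A) (a : A) {n : A}
    (hn : n ∈ N.toAddSubgroup) : a * n - a * 0 ∈ N.toAddSubgroup :=
  N.mul_sub_mul_mem (by rw [sub_self]; exact N.zero_mem) (by rwa [sub_zero])

theorem AbIdeal.mul_sub_zero_mul_mem {A : Type u} [AbMagma A] (N : AbIdeal A) (a : A) {n : A}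
    (hn : n ∈ N.toAddSubgroup) : n * a - 0 * a ∈ N.toAddSubgroup :=
  N.mul_sub_mul_mem (by rwa [sub_zero]) (by rw [sub_self]; exact N.zero_mem)

/-- The quotient of an abelian group with a binary operation by an ideal. -/
abbrev AbIdeal.Quot {A : Type u} [AbMagma A] (N : AbIdeal A) : Type u := A ⧸ N.toAddSubgroup

instance {A : Type u} [AbMagma A] (N : AbIdeal A) : AbMagma N.Quot where
  mul := Quotient.map₂ (· * ·) (by
    intro a a' h b b' h'
    rw [← Quotient.eq_iff_equiv] at h h' ⊢
    exact QuotientAddGroup.eq_iff_sub_mem.2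
      (N.mul_sub_mul_mem (QuotientAddGroup.eq_iff_sub_mem.1 h)
        (QuotientAddGroup.eq_iff_sub_mem.1 h')))
  zero_mul_zero := congrArg (QuotientAddGroup.mk (s := N.toAddSubgroup)) AbMagma.zero_mul_zero

/-- The canonical projection to the quotient by an ideal. -/
def AbIdeal.proj {A : Type u} [AbMagma A] (N : AbIdeal A) : AbMagmaHom A N.Quot :=
  .mk' (QuotientAddGroup.mk (s := N.toAddSubgroup)) (fun _ _ => rfl) (fun _ _ => rfl)

/-! ### Categories of algebras closed under subalgebras, products and quotients -/

/-- A category whose objects are abelian groups with a binary operation, whose morphisms are all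
homomorphisms, and which is a variety: up to isomorphism it contains every algebra whose points
are separated by homomorphisms to its objects (so every subalgebra of a product, of any size), and
every quotient of its objects. -/
class AbMagmaVariety (C : Type (u + 1)) [Category.{u} C] where
  carrier : C → Type u
  str : ∀ X, AbMagma (carrier X)
  hom {X Y : C} : (X ⟶ Y) → AbMagmaHom (carrier X) (carrier Y)
  ofHom {X Y : C} : AbMagmaHom (carrier X) (carrier Y) → (X ⟶ Y)
  ofHom_hom {X Y : C} (f : X ⟶ Y) : ofHom (hom f) = f
  hom_ofHom {X Y : C} (f : AbMagmaHom (carrier X) (carrier Y)) : hom (ofHom f) = f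
  hom_id {X : C} (x : carrier X) : hom (𝟙 X) x = x
  hom_comp {X Y Z : C} (f : X ⟶ Y) (g : Y ⟶ Z) (x : carrier X) :
    hom (f ≫ g) x = hom g (hom f x)
  exists_of_separated (A : Type u) [AbMagma A]
    (h : ∀ a b : A, (∀ (D : C) (f : AbMagmaHom A (carrier D)), f a = f b) → a = b) :
    ∃ (X : C) (e : AbMagmaHom (carrier X) A), Function.Bijective e
  exists_of_surjective (X : C) (A : Type u) [AbMagma A] (q : AbMagmaHom (carrier X) A)
    (h : Function.Surjective q) :
    ∃ (Y : C) (e : AbMagmaHom A (carrier Y)), Function.Bijective e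

namespace AbMagmaVariety

attribute [reducible, instance] AbMagmaVariety.str
attribute [simp] ofHom_hom hom_ofHom hom_id hom_comp

variable {C : Type (u + 1)} [Category.{u} C] [AbMagmaVariety C]

theorem hom_ext {X Y : C} {f g : X ⟶ Y} (h : ∀ x, hom f x = hom g x) : f = g := by
  rw [← ofHom_hom f, ← ofHom_hom g, DFunLike.ext _ _ h]

/-- Two morphisms out of `R` that are jointly injective on elements. -/
def JointlyInjective {R X Y : C} (p : R ⟶ X) (q : R ⟶ Y) : Prop :=
  ∀ a b, hom p a = hom p b → hom q a = hom q b → a = b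

variable (C) in
/-- The points of `A` are separated by the homomorphisms to the objects of `C`. -/
def Separated (A : Type u) [AbMagma A] : Prop :=
  ∀ a b : A, (∀ (D : C) (f : AbMagmaHom A (carrier D)), f a = f b) → a = b

theorem separated_carrier (X : C) : Separated C (carrier X) :=
  fun _ _ h => h X (.mk' id (fun _ _ => rfl) (fun _ _ => rfl))

theorem separated_prod (X Y : C) : Separated C (carrier X × carrier Y) := fun _ _ h =>
  Prod.ext (h X (.mk' Prod.fst (fun _ _ => rfl) (fun _ _ => rfl)))
    (h Y (.mk' Prod.snd (fun _ _ => rfl) (fun _ _ => rfl)))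

/-- Every subalgebra of an algebra with separated points is, up to isomorphism, an object. -/
theorem exists_subalgebra {A : Type u} [AbMagma A] (hA : Separated C A) (S : AddSubgroup A)
    (hS : ∀ a b, a ∈ S → b ∈ S → a * b ∈ S) :
    ∃ (P : C) (j : AbMagmaHom (carrier P) A), Function.Injective j ∧
      ∀ a, a ∈ S ↔ ∃ p, j p = a := by
  let : AbMagma S :=
    { mul := fun a b => ⟨a.1 * b.1, hS _ _ a.2 b.2⟩
      zero_mul_zero := Subtype.ext AbMagma.zero_mul_zero }
  let i : AbMagmaHom S A := .mk' Subtype.val (fun _ _ => rfl) (fun _ _ => rfl)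
  obtain ⟨P, e, he⟩ := exists_of_separated (C := C) S (fun a b h => Subtype.ext
    (hA _ _ fun D f => h D (f.comp i)))
  refine ⟨P, i.comp e, Subtype.val_injective.comp he.1, fun a => ⟨fun ha => ?_, ?_⟩⟩
  · obtain ⟨p, hp⟩ := he.2 ⟨a, ha⟩
    exact ⟨p, congrArg Subtype.val hp⟩
  · rintro ⟨p, rfl⟩
    exact (e p).2

/-- Every subalgebra of `X × Y` is given by a jointly injective pair of morphisms. -/
theorem exists_relation {X Y : C} (S : AddSubgroup (carrier X × carrier Y))
    (hS : ∀ a b, a ∈ S → b ∈ S → a * b ∈ S) :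
    ∃ (P : C) (p : P ⟶ X) (q : P ⟶ Y), JointlyInjective p q ∧
      ∀ x y, (x, y) ∈ S ↔ ∃ z, hom p z = x ∧ hom q z = y := by
  obtain ⟨P, j, hj, h⟩ := exists_subalgebra (separated_prod X Y) S hS
  refine ⟨P, ofHom (.mk' (fun z => (j z).1) (by simp) (by simp)),
    ofHom (.mk' (fun z => (j z).2) (by simp) (by simp)), fun a b h₁ h₂ => hj ?_, fun x y => ?_⟩
  · simp only [hom_ofHom, AbMagmaHom.mk'_apply] at h₁ h₂
    exact Prod.ext h₁ h₂
  · simp [h, Prod.ext_iff]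

theorem exists_subobject {X : C} (S : AddSubgroup (carrier X))
    (hS : ∀ a b, a ∈ S → b ∈ S → a * b ∈ S) :
    ∃ (P : C) (j : P ⟶ X), Function.Injective (hom j) ∧ ∀ x, x ∈ S ↔ ∃ p, hom j p = x := by
  obtain ⟨P, j, hj, h⟩ := exists_subalgebra (separated_carrier X) S hS
  exact ⟨P, ofHom j, by simpa using hj, by simpa using h⟩

theorem exists_quotient {X : C} (N : AbIdeal (carrier X)) :
    ∃ (Q : C) (π : X ⟶ Q), Function.Surjective (hom π) ∧
      ∀ x, hom π x = 0 ↔ x ∈ N.toAddSubgroup := by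
  have hs : Function.Surjective N.proj := QuotientAddGroup.mk_surjective
  obtain ⟨Q, e, he⟩ := exists_of_surjective X N.Quot N.proj hs
  refine ⟨Q, ofHom (e.comp N.proj), by rw [hom_ofHom]; exact he.2.comp hs, fun x => ?_⟩
  simp only [hom_ofHom, AbMagmaHom.comp_apply]
  rw [map_eq_zero_iff e he.1]
  exact QuotientAddGroup.eq_zero_iff x

/-! ### Factorizations of morphisms on elements -/

theorem exists_lift {A : Type u} [AbMagma A] {P T : C} {j : AbMagmaHom (carrier P) A}
    (hj : Function.Injective j) (f : AbMagmaHom (carrier T) A) (h : ∀ t, ∃ p, j p = f t) :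
    ∃ k : T ⟶ P, ∀ t, j (hom k t) = f t := by
  choose k hk using h
  exact ⟨ofHom (.mk' k (fun _ _ => hj (by simp [hk])) (fun _ _ => hj (by simp [hk]))),
    by simpa using hk⟩

theorem exists_lift_mono {P T X : C} {j : P ⟶ X} (hj : Function.Injective (hom j)) (f : T ⟶ X)
    (h : ∀ t, ∃ p, hom j p = hom f t) : ∃ k : T ⟶ P, k ≫ j = f := by
  obtain ⟨k, hk⟩ := exists_lift hj (hom f) h
  exact ⟨k, hom_ext (by simpa using hk)⟩

theorem JointlyInjective.exists_lift {R X Y T : C} {p : R ⟶ X} {q : R ⟶ Y}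
    (h : JointlyInjective p q) (a : T ⟶ X) (b : T ⟶ Y)
    (hab : ∀ t, ∃ r, hom p r = hom a t ∧ hom q r = hom b t) :
    ∃ k : T ⟶ R, k ≫ p = a ∧ k ≫ q = b := by
  choose k hk₁ hk₂ using hab
  refine ⟨ofHom (.mk' k (fun _ _ => h _ _ ?_ ?_) (fun _ _ => h _ _ ?_ ?_)), ?_, ?_⟩
  iterate 4 simp [hk₁, hk₂]
  · exact hom_ext (by simpa using hk₁)
  · exact hom_ext (by simpa using hk₂)

theorem JointlyInjective.cancel {R X Y T : C} {p : R ⟶ X} {q : R ⟶ Y}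
    (h : JointlyInjective p q) {a b : T ⟶ R} (h₁ : a ≫ p = b ≫ p) (h₂ : a ≫ q = b ≫ q) :
    a = b :=
  hom_ext fun t => h _ _ (by rw [← hom_comp, h₁, hom_comp]) (by rw [← hom_comp, h₂, hom_comp])

theorem exists_desc {X Q T : C} {q : X ⟶ Q} (hq : Function.Surjective (hom q)) (f : X ⟶ T)
    (h : ∀ x, hom q x = 0 → hom f x = 0) : ∃ k : Q ⟶ T, q ≫ k = f := by
  have h' : ∀ x y, hom q x = hom q y → hom f x = hom f y := fun x y e => by
    have := h (x - y) (by simp [e])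
    rwa [map_sub, sub_eq_zero] at this
  choose k hk using hq
  have key : ∀ x, hom f (k (hom q x)) = hom f x := fun x => h' _ _ (hk _)
  refine ⟨ofHom (.mk' (fun y => hom f (k y)) (fun y z => ?_) (fun y z => ?_)),
    hom_ext (by simpa using key)⟩
  · rw [← map_add]
    exact h' _ _ (by simp [hk])
  · rw [← map_mul]
    exact h' _ _ (by simp [hk])

theorem cancel_surjective {X Q T : C} {q : X ⟶ Q} (hq : Function.Surjective (hom q))
    {f g : Q ⟶ T} (h : q ≫ f = q ≫ g) : f = g := by
  refine hom_ext fun y => ?_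
  obtain ⟨x, rfl⟩ := hq y
  rw [← hom_comp, h, hom_comp]

theorem isIso_of_bijective {X Y : C} {f : X ⟶ Y} (hf : Function.Bijective (hom f)) : IsIso f := by
  obtain ⟨k, hk⟩ := exists_lift_mono hf.1 (𝟙 Y) (fun y => by simpa using hf.2 y)
  exact ⟨k, exists_lift_mono hf.1 f (fun t => ⟨t, rfl⟩) |>.elim fun _ _ =>
    hom_ext fun x => hf.1 (by rw [← hom_comp, Category.assoc, hk]; simp), hk⟩

theorem injective_of_isIso {X Y : C} (f : X ⟶ Y) [IsIso f] : Function.Injective (hom f) :=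
  Function.LeftInverse.injective (g := hom (inv f)) fun x => by rw [← hom_comp]; simp

theorem surjective_of_isIso {X Y : C} (f : X ⟶ Y) [IsIso f] : Function.Surjective (hom f) :=
  Function.RightInverse.surjective (g := hom (inv f)) fun x => by rw [← hom_comp]; simp

/-! ### Finite limits -/

variable (C) in
theorem exists_isZero : ∃ Z : C, Subsingleton (carrier Z) ∧ IsZero Z := by
  let : AbMagma PUnit.{u + 1} := { mul := fun _ _ => 0, zero_mul_zero := rfl }
  obtain ⟨Z, e, he⟩ := exists_of_separated (C := C) PUnit.{u + 1} (fun _ _ _ => rfl)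
  have hs : Subsingleton (carrier Z) := he.1.subsingleton
  refine ⟨Z, hs, ⟨fun Y => ⟨⟨⟨ofHom (.mk' (fun _ => 0) (by simp)
    (by simp [AbMagma.zero_mul_zero]))⟩, fun f => hom_ext fun x => ?_⟩⟩,
    fun Y => ⟨⟨⟨ofHom (.mk' (fun _ => 0) (by simp) (by simp [AbMagma.zero_mul_zero]))⟩,
      fun f => hom_ext fun x => Subsingleton.elim _ _⟩⟩⟩⟩
  rw [Subsingleton.elim x 0, map_zero, map_zero]

theorem isPullback_of_jointlyInjective {P X Y Z : C} {p : P ⟶ X} {q : P ⟶ Y} {f : X ⟶ Z}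
    {g : Y ⟶ Z} (w : p ≫ f = q ≫ g) (h : JointlyInjective p q)
    (hs : ∀ x y, hom f x = hom g y → ∃ z, hom p z = x ∧ hom q z = y) : IsPullback p q f g := by
  refine ⟨⟨w⟩, ⟨PullbackCone.IsLimit.mk w (fun s => (h.exists_lift s.fst s.snd fun t => hs _ _
    (by rw [← hom_comp, s.condition, hom_comp])).choose) (fun s => ?_) (fun s => ?_)
    (fun s m h₁ h₂ => ?_)⟩⟩
  all_goals generalize_proofs hk
  · exact hk.choose_spec.1
  · exact hk.choose_spec.2
  · exact h.cancel (h₁.trans hk.choose_spec.1.symm) (h₂.trans hk.choose_spec.2.symm)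

theorem exists_isPullback {X Y Z : C} (f : X ⟶ Z) (g : Y ⟶ Z) :
    ∃ (P : C) (p : P ⟶ X) (q : P ⟶ Y), IsPullback p q f g ∧ JointlyInjective p q ∧
      ∀ x y, hom f x = hom g y → ∃ z, hom p z = x ∧ hom q z = y := by
  obtain ⟨P, p, q, hj, h⟩ := exists_relation (X := X) (Y := Y)
    { carrier := {a | hom f a.1 = hom g a.2}
      add_mem' := fun {a b} ha hb => by
        simp only [Set.mem_ofPred_eq, Prod.fst_add, Prod.snd_add, map_add] at *; rw [ha, hb]
      zero_mem' := by simp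
      neg_mem' := fun {a} ha => by
        simp only [Set.mem_ofPred_eq, Prod.fst_neg, Prod.snd_neg, map_neg] at *; rw [ha] }
    (fun a b ha hb => by
      change hom f (a.1 * b.1) = hom g (a.2 * b.2)
      rw [map_mul, map_mul, show hom f a.1 = hom g a.2 from ha, show hom f b.1 = hom g b.2 from hb])
  have w : p ≫ f = q ≫ g := hom_ext fun z => by
    simpa using (h (hom p z) (hom q z)).2 ⟨z, rfl, rfl⟩
  exact ⟨P, p, q, isPullback_of_jointlyInjective w hj fun x y e => (h x y).1 e, hj,
    fun x y e => (h x y).1 e⟩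

theorem jointlyInjective_of_isPullback {P X Y Z : C} {p : P ⟶ X} {q : P ⟶ Y} {f : X ⟶ Z}
    {g : Y ⟶ Z} (h : IsPullback p q f g) : JointlyInjective p q := by
  obtain ⟨P', p', q', h', hj, -⟩ := exists_isPullback f g
  intro a b h₁ h₂
  apply injective_of_isIso (h.isoIsPullback _ _ h').hom
  apply hj <;> rw [← hom_comp, ← hom_comp] <;> simpa

theorem exists_of_isPullback {P X Y Z : C} {p : P ⟶ X} {q : P ⟶ Y} {f : X ⟶ Z}
    {g : Y ⟶ Z} (h : IsPullback p q f g) {x : carrier X} {y : carrier Y}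
    (e : hom f x = hom g y) : ∃ z, hom p z = x ∧ hom q z = y := by
  obtain ⟨P', p', q', h', -, hs⟩ := exists_isPullback f g
  obtain ⟨z, rfl, rfl⟩ := hs x y e
  refine ⟨hom (h.isoIsPullback _ _ h').inv z, ?_, ?_⟩ <;> rw [← hom_comp] <;> simp

variable (C) in
theorem hasFiniteLimits : HasFiniteLimits C := by
  obtain ⟨Z, -, hZ⟩ := exists_isZero C
  have : HasTerminal C := hZ.isTerminal.hasTerminal
  have : HasPullbacks C := by
    have : ∀ {X Y Z : C} {f : X ⟶ Z} {g : Y ⟶ Z}, HasLimit (cospan f g) := fun {_ _ _ f g} => by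
      obtain ⟨P, p, q, h, -⟩ := exists_isPullback f g
      exact h.hasPullback
    exact hasPullbacks_of_hasLimit_cospan C
  exact hasFiniteLimits_of_hasTerminal_and_pullbacks

/-! ### Monomorphisms, regular epimorphisms and exactness -/

/-- Joint injectivity follows from joint cancellability, applied to the two projections of the
object of pairs `(a, b)` with `p a = p b` and `q a = q b`. -/
theorem jointlyInjective_of_cancel {R X Y : C} {p : R ⟶ X} {q : R ⟶ Y}
    (h : ∀ {T : C} (a b : T ⟶ R), a ≫ p = b ≫ p → a ≫ q = b ≫ q → a = b) :
    JointlyInjective p q := by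
  intro r r' h₁ h₂
  obtain ⟨P, a, b, -, hP⟩ := exists_relation (X := R) (Y := R)
    { carrier := {a | hom p a.1 = hom p a.2 ∧ hom q a.1 = hom q a.2}
      add_mem' := fun {a b} ha hb => by
        simp only [Set.mem_ofPred_eq, Prod.fst_add, Prod.snd_add, map_add] at *
        rw [ha.1, hb.1, ha.2, hb.2]; simp
      zero_mem' := by simp
      neg_mem' := fun {a} ha => by
        simp only [Set.mem_ofPred_eq, Prod.fst_neg, Prod.snd_neg, map_neg] at *
        rw [ha.1, ha.2]; simp }
    (fun a b ha hb => by
      change hom p (a.1 * b.1) = hom p (a.2 * b.2) ∧ hom q (a.1 * b.1) = hom q (a.2 * b.2)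
      change hom p a.1 = hom p a.2 ∧ hom q a.1 = hom q a.2 at ha
      change hom p b.1 = hom p b.2 ∧ hom q b.1 = hom q b.2 at hb
      simp only [map_mul]
      rw [ha.1, hb.1, ha.2, hb.2]; simp)
  have hab : a = b := by
    refine h a b (hom_ext fun z => ?_) (hom_ext fun z => ?_)
    · simpa using ((hP (hom a z) (hom b z)).2 ⟨z, rfl, rfl⟩).1
    · simpa using ((hP (hom a z) (hom b z)).2 ⟨z, rfl, rfl⟩).2
  obtain ⟨z, rfl, rfl⟩ := (hP r r').1 ⟨h₁, h₂⟩
  rw [hab]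

theorem injective_of_mono {X Y : C} (f : X ⟶ Y) [Mono f] : Function.Injective (hom f) :=
  fun a b h => jointlyInjective_of_cancel (p := f) (q := f)
    (fun _ _ h _ => (cancel_mono f).1 h) a b h h

theorem mono_of_injective {X Y : C} {f : X ⟶ Y} (h : Function.Injective (hom f)) : Mono f :=
  ⟨fun _ _ e => hom_ext fun t => h (by rw [← hom_comp, e, hom_comp])⟩

/-- The image factorization: a surjection followed by an injection. -/
theorem exists_image {X Y : C} (f : X ⟶ Y) :
    ∃ (I : C) (e : X ⟶ I) (m : I ⟶ Y), e ≫ m = f ∧ Function.Surjective (hom e) ∧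
      Function.Injective (hom m) := by
  obtain ⟨I, m, hm, h⟩ := exists_subobject (hom f).toAddMonoidHom.range (by
    rintro _ _ ⟨x, rfl⟩ ⟨y, rfl⟩
    exact ⟨x * y, map_mul (hom f) x y⟩)
  obtain ⟨e, he⟩ := exists_lift_mono hm f (fun t => (h _).1 ⟨t, rfl⟩)
  refine ⟨I, e, m, he, fun i => ?_, hm⟩
  obtain ⟨x, hx⟩ := (h (hom m i)).2 ⟨i, rfl⟩
  exact ⟨x, hm (by rw [← hom_comp, he]; exact hx)⟩

/-- A surjection is the coequalizer of its kernel pair. -/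
theorem nonempty_isColimit_cofork {R X Q : C} {p q : R ⟶ X} {π : X ⟶ Q} (w : p ≫ π = q ≫ π)
    (hπ : Function.Surjective (hom π))
    (h : ∀ x, hom π x = 0 → ∃ r, hom p r = x ∧ hom q r = 0) :
    Nonempty (IsColimit (Cofork.ofπ π w)) := by
  have key : ∀ s : Cofork p q, ∃ k, π ≫ k = s.π := fun s => exists_desc hπ s.π fun x hx => by
    obtain ⟨r, rfl, hr⟩ := h x hx
    rw [← hom_comp, s.condition, hom_comp, hr, map_zero]
  exact ⟨Cofork.IsColimit.mk _ (fun s => (key s).choose) (fun s => (key s).choose_spec)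
    fun s m hm => cancel_surjective hπ (hm.trans (key s).choose_spec.symm)⟩

theorem isRegularEpi_iff_surjective {X Y : C} (f : X ⟶ Y) :
    IsRegularEpi f ↔ Function.Surjective (hom f) := by
  constructor
  · rintro ⟨⟨r⟩⟩
    obtain ⟨I, e, m, he, hes, hm⟩ := exists_image f
    have := mono_of_injective hm
    have h : r.left ≫ e = r.right ≫ e := by
      rw [← cancel_mono m, Category.assoc, Category.assoc, he, r.w]
    obtain ⟨d, hd⟩ := Cofork.IsColimit.desc' r.isColimit e h
    have hd' : f ≫ d = e := hd
    have : d ≫ m = 𝟙 Y := Cofork.IsColimit.hom_ext r.isColimit (by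
      change f ≫ d ≫ m = f ≫ 𝟙 Y
      rw [← Category.assoc, hd', he, Category.comp_id])
    intro y
    obtain ⟨x, hx⟩ := hes (hom d y)
    exact ⟨x, by rw [← he, hom_comp, hx, ← hom_comp, this]; exact hom_id y⟩
  · intro h
    obtain ⟨P, p, q, hP, -, hs⟩ := exists_isPullback f f
    obtain ⟨hc⟩ := nonempty_isColimit_cofork hP.w h fun x hx => hs x 0 (by rw [hx, map_zero])
    exact ⟨⟨⟨P, p, q, hP.w, hc⟩⟩⟩

variable (C) in
theorem regular : Regular C where
  __ := hasFiniteLimits C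
  hasCoequalizer_of_isKernelPair {X Y Z f g₁ g₂} h := by
    obtain ⟨I, e, m, he, hes, hm⟩ := exists_image f
    have := mono_of_injective hm
    have w : g₁ ≫ e = g₂ ≫ e := by
      rw [← cancel_mono m, Category.assoc, Category.assoc, he, h.w]
    obtain ⟨hc⟩ := nonempty_isColimit_cofork w hes fun x hx => exists_of_isPullback h (by
      rw [← he, hom_comp, hx, map_zero, map_zero])
    exact ⟨⟨⟨_, hc⟩⟩⟩
  regularEpiIsStableUnderBaseChange := ⟨fun {X Y Y' S f g f' g'} h hg => by
    refine (isRegularEpi_iff_surjective _).2 fun y => ?_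
    obtain ⟨x, hx⟩ := (isRegularEpi_iff_surjective _).1 hg (hom f y)
    obtain ⟨z, -, hz⟩ := exists_of_isPullback h hx
    exact ⟨z, hz⟩⟩

/-- On elements, a reflexive relation is congruence modulo an ideal: it is a subalgebra containing
the diagonal, so `(x, y)` belongs to it if and only if `(x - y, 0)` does. -/
theorem exists_ideal_of_reflexive {R X : C} {p q : R ⟶ X} (r : X ⟶ R) (h₁ : r ≫ p = 𝟙 X)
    (h₂ : r ≫ q = 𝟙 X) : ∃ N : AbIdeal (carrier X), ∀ x y,
      (∃ z, hom p z = x ∧ hom q z = y) ↔ x - y ∈ N.toAddSubgroup := by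
  have r₁ : ∀ x, hom p (hom r x) = x := fun x => by rw [← hom_comp, h₁, hom_id]
  have r₂ : ∀ x, hom q (hom r x) = x := fun x => by rw [← hom_comp, h₂, hom_id]
  have key : ∀ x y, (∃ z, hom p z = x ∧ hom q z = y) ↔ ∃ z, hom p z = x - y ∧ hom q z = 0 := by
    refine fun x y => ⟨?_, ?_⟩
    · rintro ⟨z, rfl, rfl⟩
      exact ⟨z - hom r (hom q z), by simp [r₁], by simp [r₂]⟩
    · rintro ⟨z, hx, hy⟩
      exact ⟨z + hom r y, by simp [r₁, hx], by simp [r₂, hy]⟩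
  refine ⟨{ carrier := {x | ∃ z, hom p z = x ∧ hom q z = 0}
            add_mem' := ?_, zero_mem' := ⟨0, by simp⟩, neg_mem' := ?_, mul_sub_mul_mem := ?_ },
    key⟩
  · rintro _ _ ⟨z, rfl, hz⟩ ⟨z', rfl, hz'⟩
    exact ⟨z + z', by simp, by simp [hz, hz']⟩
  · rintro _ ⟨z, rfl, hz⟩
    exact ⟨-z, by simp, by simp [hz]⟩
  · intro a a' b b' h h'
    obtain ⟨z, rfl, rfl⟩ := (key a a').2 h
    obtain ⟨z', rfl, rfl⟩ := (key b b').2 h'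
    exact (key _ _).1 ⟨z * z', by simp, by simp⟩

/-- Every reflexive relation is an equivalence relation. -/
theorem isEquivalenceRelation_of_reflexive {R X : C} {p q : R ⟶ X}
    (h : ReflexiveRelation p q) : IsEquivalenceRelation p q := by
  have hj : JointlyInjective p q :=
    jointlyInjective_of_cancel fun a b => h.right_cancellation a b
  obtain ⟨N, hN⟩ := exists_ideal_of_reflexive h.r h.reflexivity₁ h.reflexivity₂
  obtain ⟨s, hs₁, hs₂⟩ := hj.exists_lift q p fun t => (hN _ _).2 (by
    rw [← neg_sub]; exact neg_mem ((hN _ _).1 ⟨t, rfl, rfl⟩))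
  obtain ⟨P, a, b, hP, -⟩ := exists_isPullback q p
  obtain ⟨t, ht₁, ht₂⟩ := hj.exists_lift (a ≫ p) (b ≫ q) fun t => (hN _ _).2 (by
    have e : hom q (hom a t) = hom p (hom b t) := by rw [← hom_comp, hP.w, hom_comp]
    have := add_mem ((hN _ _).1 ⟨hom a t, rfl, rfl⟩) ((hN _ _).1 ⟨hom b t, rfl, rfl⟩)
    rw [e] at this
    simpa using this)
  exact ⟨⟨{ h with
    s := s, symmetry₁ := hs₁, symmetry₂ := hs₂, c := hP.cone, isLimit := hP.isLimit
    t := t, transitivity₁ := ht₁, transitivity₂ := ht₂ }⟩⟩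

/-- An equivalence relation is the kernel pair of the quotient by the corresponding ideal. -/
theorem isEffectiveEquivalenceRelation {R X : C} {p q : R ⟶ X}
    (h : EquivalenceRelation p q) : IsEffectiveEquivalenceRelation p q := by
  have hj : JointlyInjective p q :=
    jointlyInjective_of_cancel fun a b => h.right_cancellation a b
  obtain ⟨N, hN⟩ := exists_ideal_of_reflexive h.r h.reflexivity₁ h.reflexivity₂
  obtain ⟨Q, π, hπ, hπN⟩ := exists_quotient N
  have w : p ≫ π = q ≫ π := hom_ext fun z => by
    rw [hom_comp, hom_comp, ← sub_eq_zero, ← map_sub, hπN]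
    exact (hN _ _).1 ⟨z, rfl, rfl⟩
  have hk : IsKernelPair π p q := isPullback_of_jointlyInjective w hj fun x y e => (hN x y).2 (by
    rw [← hπN, map_sub, e, sub_self])
  obtain ⟨hc⟩ := nonempty_isColimit_cofork w hπ fun x hx => (hN x 0).2 (by rw [sub_zero, ← hπN, hx])
  have key : ∀ s : PushoutCocone p q, s.inl = s.inr := fun s => by
    have := congrArg (h.r ≫ ·) s.condition
    simpa using this
  refine ⟨⟨{ h with B := Q, π := π, isKernelPair := hk, isPushout := ⟨⟨w⟩, ⟨?_⟩⟩ }⟩⟩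
  refine PushoutCocone.IsColimit.mk w
    (fun s => (Cofork.IsColimit.desc' hc s.inl (by rw [s.condition, key])).1)
    (fun s => (Cofork.IsColimit.desc' hc s.inl _).2)
    (fun s => (Cofork.IsColimit.desc' hc s.inl _).2.trans (key s))
    (fun s m h₁ _ => cancel_surjective hπ (h₁.trans (Cofork.IsColimit.desc' hc s.inl _).2.symm))

variable (C) in
theorem barrExact : BarrExact C where
  __ := regular C
  effective _ _ h := isEffectiveEquivalenceRelation h.nonempty_equivalenceRelation.some

end AbMagmaVariety

/-! ### Points and change of base -/

section

variable {C : Type u} [Category.{v} C]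

theorem Pt.isIso_of_isIso_hom {Y : C} {P Q : Pt Y} (g : P ⟶ Q) [IsIso g.hom] : IsIso g :=
  ⟨⟨inv g.hom, by rw [IsIso.inv_comp_eq, g.comm_f], by rw [IsIso.comp_inv_eq, g.comm_s]⟩,
    Pt.hom_ext (IsIso.hom_inv_id g.hom), Pt.hom_ext (IsIso.inv_hom_id g.hom)⟩

theorem Pt.isIso_hom {Y : C} {P Q : Pt Y} (g : P ⟶ Q) [IsIso g] : IsIso g.hom :=
  ⟨(inv g).hom, by rw [← Pt.comp_hom, IsIso.hom_inv_id, Pt.id_hom],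
    by rw [← Pt.comp_hom, IsIso.inv_hom_id, Pt.id_hom]⟩

/-- The projection `P ×_Y Z ⟶ P` from the base change of a point. -/
noncomputable def Pt.baseChangeFst [HasPullbacks C] {Z Y : C} (w : Z ⟶ Y) (P : Pt Y) :
    ((Pt.baseChange w).obj P).X ⟶ P.X :=
  pullback.fst P.f w

theorem Pt.isPullback_baseChange [HasPullbacks C] {Z Y : C} (w : Z ⟶ Y) (P : Pt Y) :
    IsPullback (Pt.baseChangeFst w P) ((Pt.baseChange w).obj P).f P.f w :=
  IsPullback.of_hasPullback P.f w

theorem Pt.map_comp_baseChangeFst [HasPullbacks C] {Z Y : C} (w : Z ⟶ Y) {P Q : Pt Y} (g : P ⟶ Q) :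
    ((Pt.baseChange w).map g).hom ≫ Pt.baseChangeFst w Q = Pt.baseChangeFst w P ≫ g.hom :=
  pullback.lift_fst _ _ _

end

/-! ### Binary coproducts -/

/-- Terms in the operations `+`, `0`, `-`, `*` with variables from `A` and from `B`. -/
inductive CoprodTerm (A B : Type u) : Type u
  | inl : A → CoprodTerm A B
  | inr : B → CoprodTerm A B
  | zero : CoprodTerm A B
  | add : CoprodTerm A B → CoprodTerm A B → CoprodTerm A B
  | neg : CoprodTerm A B → CoprodTerm A B
  | mul : CoprodTerm A B → CoprodTerm A B → CoprodTerm A B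

namespace AbMagmaVariety

variable {C : Type (u + 1)} [Category.{u} C] [AbMagmaVariety C]

/-- The value of a term in `D`, once its variables are mapped to `D`. -/
def termValue {A B D : C} (f : A ⟶ D) (g : B ⟶ D) : CoprodTerm (carrier A) (carrier B) → carrier D
  | .inl a => hom f a
  | .inr b => hom g b
  | .zero => 0
  | .add s t => termValue f g s + termValue f g t
  | .neg s => -termValue f g s
  | .mul s t => termValue f g s * termValue f g t

/-- Terms are identified when they have the same value in every object of the category. -/
def termSetoid (A B : C) : Setoid (CoprodTerm (carrier A) (carrier B)) where
  r s t := ∀ (D : C) (f : A ⟶ D) (g : B ⟶ D), termValue f g s = termValue f g t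
  iseqv := ⟨fun _ _ _ _ => rfl, fun h D f g => (h D f g).symm,
    fun h h' D f g => (h D f g).trans (h' D f g)⟩

/-- The underlying set of the coproduct of `A` and `B`: terms modulo identity of their values. -/
def CoprodCarrier (A B : C) : Type u := Quotient (termSetoid A B)

/-- The map out of the coproduct induced by two morphisms, on elements. -/
def evalCoprod {A B D : C} (f : A ⟶ D) (g : B ⟶ D) : CoprodCarrier A B → carrier D :=
  Quotient.lift (termValue f g) fun _ _ h => h D f g

theorem evalCoprod_separates {A B : C} {x y : CoprodCarrier A B}
    (h : ∀ (D : C) (f : A ⟶ D) (g : B ⟶ D), evalCoprod f g x = evalCoprod f g y) : x = y := by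
  induction x using Quotient.ind
  induction y using Quotient.ind
  exact Quotient.sound h

instance (A B : C) : Zero (CoprodCarrier A B) := ⟨Quotient.mk _ .zero⟩

instance (A B : C) : Add (CoprodCarrier A B) :=
  ⟨Quotient.map₂ .add fun _ _ h _ _ h' D f g => congrArg₂ (· + ·) (h D f g) (h' D f g)⟩

instance (A B : C) : Neg (CoprodCarrier A B) :=
  ⟨Quotient.map .neg fun _ _ h D f g => congrArg (- ·) (h D f g)⟩

instance (A B : C) : Mul (CoprodCarrier A B) :=
  ⟨Quotient.map₂ .mul fun _ _ h _ _ h' D f g => congrArg₂ (· * ·) (h D f g) (h' D f g)⟩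

section

variable {A B D : C} (f : A ⟶ D) (g : B ⟶ D)

theorem evalCoprod_zero : evalCoprod f g 0 = 0 := rfl

theorem evalCoprod_add (x y : CoprodCarrier A B) :
    evalCoprod f g (x + y) = evalCoprod f g x + evalCoprod f g y := by
  induction x using Quotient.ind
  induction y using Quotient.ind
  rfl

theorem evalCoprod_neg (x : CoprodCarrier A B) : evalCoprod f g (-x) = -evalCoprod f g x := by
  induction x using Quotient.ind
  rfl

theorem evalCoprod_mul (x y : CoprodCarrier A B) :
    evalCoprod f g (x * y) = evalCoprod f g x * evalCoprod f g y := by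
  induction x using Quotient.ind
  induction y using Quotient.ind
  rfl

end

instance (A B : C) : AbMagma (CoprodCarrier A B) where
  add_assoc x y z := evalCoprod_separates fun D f g => by simp only [evalCoprod_add, add_assoc]
  zero_add x := evalCoprod_separates fun D f g => by
    simp only [evalCoprod_add, evalCoprod_zero, zero_add]
  add_zero x := evalCoprod_separates fun D f g => by
    simp only [evalCoprod_add, evalCoprod_zero, add_zero]
  neg_add_cancel x := evalCoprod_separates fun D f g => by
    simp only [evalCoprod_add, evalCoprod_neg, evalCoprod_zero, neg_add_cancel]
  add_comm x y := evalCoprod_separates fun D f g => by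
    simp only [evalCoprod_add]
    exact add_comm _ _
  nsmul := nsmulRec
  zsmul := zsmulRec
  zero_mul_zero := evalCoprod_separates fun D f g => by
    simp only [evalCoprod_mul, evalCoprod_zero, AbMagma.zero_mul_zero]

/-- The map out of the coproduct induced by two morphisms. -/
def evalCoprodHom {A B D : C} (f : A ⟶ D) (g : B ⟶ D) :
    AbMagmaHom (CoprodCarrier A B) (carrier D) :=
  .mk' (evalCoprod f g) (evalCoprod_add f g) (evalCoprod_mul f g)

theorem exists_coproduct (A B : C) : ∃ (Q : C) (i : A ⟶ Q) (j : B ⟶ Q),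
    Nonempty (IsColimit (BinaryCofan.mk i j)) := by
  obtain ⟨Q, e, he⟩ := exists_of_separated (C := C) (CoprodCarrier A B) fun x y h =>
    evalCoprod_separates fun D f g => h D (evalCoprodHom f g)
  obtain ⟨i, hi⟩ := exists_lift he.1 (T := A) (.mk' (fun a => Quotient.mk _ (.inl a))
    (fun x y => evalCoprod_separates fun D f g => map_add (hom f) x y)
    (fun x y => evalCoprod_separates fun D f g => map_mul (hom f) x y)) fun t => he.2 _
  obtain ⟨j, hj⟩ := exists_lift he.1 (T := B) (.mk' (fun b => Quotient.mk _ (.inr b))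
    (fun x y => evalCoprod_separates fun D f g => map_add (hom g) x y)
    (fun x y => evalCoprod_separates fun D f g => map_mul (hom g) x y)) fun t => he.2 _
  have hdesc : ∀ {D : C} (f : A ⟶ D) (g : B ⟶ D), ∃ k : Q ⟶ D, i ≫ k = f ∧ j ≫ k = g := by
    refine fun f g => ⟨ofHom ((evalCoprodHom f g).comp e), hom_ext fun x => ?_,
      hom_ext fun x => ?_⟩
    · rw [hom_comp, hom_ofHom, AbMagmaHom.comp_apply, hi]; rfl
    · rw [hom_comp, hom_ofHom, AbMagmaHom.comp_apply, hj]; rfl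
  -- every element is the class of a term, so uniqueness is an induction on terms
  have huniq : ∀ {D : C} (k l : Q ⟶ D), i ≫ k = i ≫ l → j ≫ k = j ≫ l → k = l := by
    refine fun {D} k l hik hjk => hom_ext fun x => ?_
    suffices h : ∀ t x, e x = Quotient.mk _ t → hom k x = hom l x by
      obtain ⟨t, ht⟩ := Quotient.exists_rep (e x)
      exact h t x ht.symm
    intro t
    induction t with
    | inl a =>
      intro x hx
      obtain rfl : x = hom i a := he.1 (by rw [hx, hi]; rfl)
      rw [← hom_comp, hik, hom_comp]
    | inr b =>
      intro x hx
      obtain rfl : x = hom j b := he.1 (by rw [hx, hj]; rfl)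
      rw [← hom_comp, hjk, hom_comp]
    | zero =>
      intro x hx
      obtain rfl : x = 0 := he.1 (by rw [hx, map_zero]; rfl)
      simp
    | add s t hs ht =>
      intro x hx
      obtain ⟨y, hy⟩ := he.2 (Quotient.mk _ s)
      obtain ⟨z, hz⟩ := he.2 (Quotient.mk _ t)
      obtain rfl : x = y + z := he.1 (by rw [hx, map_add, hy, hz]; rfl)
      rw [map_add, map_add, hs y hy, ht z hz]
    | neg s hs =>
      intro x hx
      obtain ⟨y, hy⟩ := he.2 (Quotient.mk _ s)
      obtain rfl : x = -y := he.1 (by rw [hx, map_neg, hy]; rfl)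
      rw [map_neg, map_neg, hs y hy]
    | mul s t hs ht =>
      intro x hx
      obtain ⟨y, hy⟩ := he.2 (Quotient.mk _ s)
      obtain ⟨z, hz⟩ := he.2 (Quotient.mk _ t)
      obtain rfl : x = y * z := he.1 (by rw [hx, map_mul, hy, hz]; rfl)
      rw [map_mul, map_mul, hs y hy, ht z hz]
  exact ⟨Q, i, j, ⟨BinaryCofan.isColimitMk (fun s => (hdesc s.inl s.inr).choose)
    (fun s => (hdesc s.inl s.inr).choose_spec.1) (fun s => (hdesc s.inl s.inr).choose_spec.2)
    fun s m h₁ h₂ => huniq _ _ (h₁.trans (hdesc s.inl s.inr).choose_spec.1.symm)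
      (h₂.trans (hdesc s.inl s.inr).choose_spec.2.symm)⟩⟩

variable (C) in
theorem hasBinaryCoproducts : HasBinaryCoproducts C := by
  have : ∀ {X Y : C}, HasColimit (pair X Y) := fun {X Y} => by
    obtain ⟨Q, i, j, ⟨h⟩⟩ := exists_coproduct X Y
    exact ⟨⟨⟨_, h⟩⟩⟩
  exact hasBinaryCoproducts_of_hasColimit_pair C

/-! ### Protomodularity -/

theorem point_section {Y : C} (P : Pt Y) (y : carrier Y) : hom P.f (hom P.s y) = y := by
  rw [← hom_comp, P.sf, hom_id]

theorem point_hom_f {Y : C} {P Q : Pt Y} (g : P ⟶ Q) (x : carrier P.X) :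
    hom Q.f (hom g.hom x) = hom P.f x := by
  rw [← hom_comp, g.comm_f]

theorem point_hom_s {Y : C} {P Q : Pt Y} (g : P ⟶ Q) (y : carrier Y) :
    hom g.hom (hom P.s y) = hom Q.s y := by
  rw [← hom_comp, g.comm_s]

theorem baseChangeFst_map [HasPullbacks C] {Z Y : C} (w : Z ⟶ Y) {P Q : Pt Y} (g : P ⟶ Q)
    (x : carrier ((Pt.baseChange w).obj P).X) :
    hom (Pt.baseChangeFst w Q) (hom ((Pt.baseChange w).map g).hom x) =
      hom g.hom (hom (Pt.baseChangeFst w P) x) := by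
  rw [← hom_comp, ← hom_comp, Pt.map_comp_baseChangeFst]

/-- Base change restricts to an isomorphism between the kernels, so it reflects injectivity. -/
theorem injective_of_injective_baseChange [HasPullbacks C] {Z Y : C} {w : Z ⟶ Y} {P Q : Pt Y}
    {g : P ⟶ Q} (h : Function.Injective (hom ((Pt.baseChange w).map g).hom)) :
    Function.Injective (hom g.hom) := by
  refine (injective_iff_map_eq_zero (hom g.hom)).2 fun x hx => ?_
  have hf : hom P.f x = hom w 0 := by rw [← point_hom_f g, hx, map_zero, map_zero]
  obtain ⟨z, rfl, hz⟩ := exists_of_isPullback (Pt.isPullback_baseChange w P) hf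
  rw [(injective_iff_map_eq_zero _).1 h z (jointlyInjective_of_isPullback
    (Pt.isPullback_baseChange w Q) _ _ (by rw [baseChangeFst_map, hx, map_zero])
    (by rw [point_hom_f, hz, map_zero])), map_zero]

/-- An element of a point over `Y` is the sum of an element of the kernel and an element of `Y`;
hence base change reflects surjectivity. -/
theorem surjective_of_surjective_baseChange [HasPullbacks C] {Z Y : C} {w : Z ⟶ Y} {P Q : Pt Y}
    {g : P ⟶ Q} (h : Function.Surjective (hom ((Pt.baseChange w).map g).hom)) :
    Function.Surjective (hom g.hom) := by
  intro q
  have hf : hom Q.f (q - hom Q.s (hom Q.f q)) = hom w 0 := by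
    rw [map_sub, point_section, sub_self, map_zero]
  obtain ⟨z, hz, -⟩ := exists_of_isPullback (Pt.isPullback_baseChange w Q) hf
  obtain ⟨x, rfl⟩ := h z
  refine ⟨hom (Pt.baseChangeFst w P) x + hom P.s (hom Q.f q), ?_⟩
  rw [map_add, point_hom_s, ← baseChangeFst_map, hz, sub_add_cancel]

variable (C) in
theorem protomodular [HasPullbacks C] : Protomodular C := fun w => ⟨fun {P Q} g _ => by
  have := Pt.isIso_hom ((Pt.baseChange w).map g)
  have : IsIso g.hom := isIso_of_bijective
    ⟨injective_of_injective_baseChange (injective_of_isIso ((Pt.baseChange w).map g).hom),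
      surjective_of_surjective_baseChange (surjective_of_isIso ((Pt.baseChange w).map g).hom)⟩
  exact Pt.isIso_of_isIso_hom g⟩

variable (C) in
theorem semiAbelian [HasZeroMorphisms C] : SemiAbelian C where
  __ := barrExact C
  hasZeroObject := let ⟨Z, _, hZ⟩ := exists_isZero C; ⟨Z, hZ⟩
  hasBinaryCoproducts := hasBinaryCoproducts C
  protomodular := have := hasFiniteLimits C; protomodular C

end AbMagmaVariety

/-! ### Normal monomorphisms -/

/-- The kernel of a homomorphism. -/
def AbIdeal.ker {A B : Type u} [AbMagma A] [AbMagma B] (f : AbMagmaHom A B) : AbIdeal A where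
  __ := f.toAddMonoidHom.ker
  mul_sub_mul_mem {a a' b b'} h h' := by
    change f (a - a') = 0 at h
    change f (b - b') = 0 at h'
    change f (a * b - a' * b') = 0
    rw [map_sub, sub_eq_zero] at *
    rw [map_mul, map_mul, h, h']

theorem AbIdeal.mem_ker {A B : Type u} [AbMagma A] [AbMagma B] {f : AbMagmaHom A B} {x : A} :
    x ∈ (AbIdeal.ker f).toAddSubgroup ↔ f x = 0 := Iff.rfl

namespace AbMagmaVariety

variable {C : Type (u + 1)} [Category.{u} C] [AbMagmaVariety C]

theorem hom_zero [HasZeroMorphisms C] {X Y : C} (x : carrier X) : hom (0 : X ⟶ Y) x = 0 := by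
  obtain ⟨Z, hs, -⟩ := exists_isZero C
  rw [← comp_zero (f := (0 : X ⟶ Z)), hom_comp, Subsingleton.elim (hom (0 : X ⟶ Z) x) 0, map_zero]

theorem exists_kernel [HasZeroMorphisms C] {X Y : C} (f : X ⟶ Y) :
    ∃ (K : C) (k : K ⟶ X), k ≫ f = 0 ∧ ∀ x, hom f x = 0 → ∃ a, hom k a = x := by
  obtain ⟨Z, hs, -⟩ := exists_isZero C
  obtain ⟨K, k, l, hK, -, h⟩ := exists_isPullback f (0 : Z ⟶ Y)
  refine ⟨K, k, by rw [hK.w, comp_zero], fun x hx => ?_⟩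
  obtain ⟨a, ha, -⟩ := h x 0 (by rw [hx, map_zero])
  exact ⟨a, ha⟩

theorem exists_kernel_mk [HasZeroMorphisms C] {X Y : C} {f : X ⟶ Y} [HasKernel f] {x : carrier X}
    (hx : hom f x = 0) : ∃ a, hom (kernel.ι f) a = x := by
  obtain ⟨K, k, w, h⟩ := exists_kernel f
  obtain ⟨a, rfl⟩ := h x hx
  exact ⟨hom (kernel.lift f k w) a, by rw [← hom_comp, kernel.lift_ι]⟩

theorem exists_ideal_of_isNormalMono [HasZeroMorphisms C] {K X : C} {k : K ⟶ X}
    (h : IsNormalMono k) :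
    ∃ N : AbIdeal (carrier X), ∀ x, x ∈ N.toAddSubgroup ↔ ∃ a, hom k a = x := by
  obtain ⟨n⟩ := h
  refine ⟨.ker (hom n.g), fun x => ⟨fun hx => ?_, ?_⟩⟩
  · obtain ⟨L, l, w, hl⟩ := exists_kernel n.g
    obtain ⟨a, rfl⟩ := hl x hx
    obtain ⟨j, hj⟩ := KernelFork.IsLimit.lift' n.isLimit l w
    have hj' : j ≫ k = l := hj
    exact ⟨hom j a, by rw [← hom_comp, hj']⟩
  · rintro ⟨a, rfl⟩
    rw [AbIdeal.mem_ker, ← hom_comp, n.w, hom_zero]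

theorem isNormalMono_of_ker [HasZeroMorphisms C] {K X Z : C} {k : K ⟶ X}
    (hk : Function.Injective (hom k)) (g : X ⟶ Z) (h : ∀ x, hom g x = 0 ↔ ∃ a, hom k a = x) :
    IsNormalMono k := by
  have := mono_of_injective hk
  have key : ∀ {T : C} (t : T ⟶ X), t ≫ g = 0 → ∃ l : T ⟶ K, l ≫ k = t := fun t ht =>
    exists_lift_mono hk t fun x => (h _).1 (by rw [← hom_comp, ht, hom_zero])
  have w : k ≫ g = 0 := hom_ext fun a => by rw [hom_comp, hom_zero, h]; exact ⟨a, rfl⟩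
  refine ⟨⟨Z, g, w, KernelFork.IsLimit.ofι k w (fun t ht => (key t ht).choose)
    (fun t ht => (key t ht).choose_spec) (fun t ht l hl => ?_)⟩⟩
  rw [← cancel_mono k, hl, (key t ht).choose_spec]

/-- The kernel pair of `m` is a point over `Y`, so monomorphisms of points are injective. -/
theorem injective_of_mono_point {Y : C} {P Q : Pt Y} (m : P ⟶ Q) [Mono m] :
    Function.Injective (hom m.hom) := by
  obtain ⟨T, a, b, hT, -, h⟩ := exists_isPullback m.hom m.hom
  let T' : Pt Y := ⟨T, a ≫ P.f, hT.lift P.s P.s rfl, by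
    rw [← Category.assoc, hT.lift_fst, P.sf]⟩
  let a' : T' ⟶ P := ⟨a, rfl, hT.lift_fst _ _ _⟩
  let b' : T' ⟶ P := ⟨b, by
    change b ≫ P.f = a ≫ P.f
    rw [← m.comm_f, ← Category.assoc, ← hT.w, Category.assoc], hT.lift_snd _ _ _⟩
  have hab : a' = b' := (cancel_mono m).1 (Pt.hom_ext hT.w)
  have hab' : a = b := congrArg Pt.Hom.hom hab
  intro x y hxy
  obtain ⟨z, rfl, rfl⟩ := h x y hxy
  rw [hab']

/-- A normal monomorphism of points over `Y` is injective, and it maps the kernel of its domain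
onto an ideal of its codomain. -/
theorem injective_and_exists_ideal_of_isNormalMono {Y : C} {P Q : Pt Y} {m : P ⟶ Q}
    (h : IsNormalMono m) : Function.Injective (hom m.hom) ∧ ∃ N : AbIdeal (carrier Q.X),
      ∀ x, x ∈ N.toAddSubgroup ↔ ∃ p, hom P.f p = 0 ∧ hom m.hom p = x := by
  obtain ⟨⟨R, g, w, hl⟩⟩ := h
  have : Mono m := mono_of_isLimit_fork hl
  refine ⟨injective_of_mono_point m, .ker (hom g.hom), fun x => ⟨fun hx => ?_, ?_⟩⟩
  · -- the kernel of `g` in the category of points is the pullback of `g` along the section of `R`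
    obtain ⟨T, a, b, hT, -, hs⟩ := exists_isPullback g.hom R.s
    have hab : a ≫ Q.f = b := by
      rw [← g.comm_f, ← Category.assoc, hT.w, Category.assoc, R.sf, Category.comp_id]
    let T' : Pt Y := ⟨T, a ≫ Q.f, hT.lift Q.s (𝟙 Y) (by rw [g.comm_s, Category.id_comp]), by
      rw [← Category.assoc, hT.lift_fst, Q.sf]⟩
    let t : T' ⟶ Q := ⟨a, rfl, hT.lift_fst _ _ _⟩
    have ht : t ≫ g = 0 := Pt.hom_ext (by
      change a ≫ g.hom = (a ≫ Q.f) ≫ R.s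
      rw [hT.w, hab])
    obtain ⟨j, hj⟩ := KernelFork.IsLimit.lift' hl t ht
    have hj' : j.hom ≫ m.hom = a := congrArg Pt.Hom.hom (show j ≫ m = t from hj)
    have hx' : hom g.hom x = 0 := hx
    obtain ⟨z, rfl, hz⟩ := hs x 0 (by rw [hx', map_zero])
    have e : hom m.hom (hom j.hom z) = hom a z := by rw [← hom_comp, hj']
    refine ⟨hom j.hom z, ?_, e⟩
    rw [← point_hom_f m, e, ← hom_comp, hab, hz]
  · rintro ⟨p, hp, rfl⟩
    have e : m.hom ≫ g.hom = P.f ≫ R.s := congrArg Pt.Hom.hom w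
    rw [AbIdeal.mem_ker, ← hom_comp, e, hom_comp, hp, map_zero]

/-- If the image of the kernel of `P` under an injective `m` is an ideal `N` of `Q`, then `m` is the
kernel of the projection from `Q` to `Q / N`, in the category of points. -/
theorem isNormalMono_of_ideal {Y : C} {P Q : Pt Y} {m : P ⟶ Q}
    (hm : Function.Injective (hom m.hom)) (N : AbIdeal (carrier Q.X))
    (hN : ∀ x, x ∈ N.toAddSubgroup ↔ ∃ p, hom P.f p = 0 ∧ hom m.hom p = x) : IsNormalMono m := by
  obtain ⟨R, π, hπ, hπN⟩ := exists_quotient N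
  have hmono := mono_of_injective hm
  obtain ⟨f, hf⟩ := exists_desc hπ Q.f (fun x hx => by
    obtain ⟨p, hp, rfl⟩ := (hN x).1 ((hπN x).1 hx)
    rw [point_hom_f, hp])
  let R' : Pt Y := ⟨R, f, Q.s ≫ π, by rw [Category.assoc, hf, Q.sf]⟩
  let g : Q ⟶ R' := ⟨π, hf, rfl⟩
  have w : m ≫ g = 0 := Pt.hom_ext (hom_ext fun p => by
    change hom (m.hom ≫ π) p = hom (P.f ≫ Q.s ≫ π) p
    rw [hom_comp, hom_comp, hom_comp, ← sub_eq_zero, ← map_sub, hπN, hN]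
    exact ⟨p - hom P.s (hom P.f p), by rw [map_sub, point_section, sub_self],
      by rw [map_sub, point_hom_s]⟩)
  have key : ∀ {T : Pt Y} (t : T ⟶ Q), t ≫ g = 0 → ∃ k : T ⟶ P, k ≫ m = t := by
    intro T t ht
    have ht' : t.hom ≫ π = T.f ≫ Q.s ≫ π := congrArg Pt.Hom.hom ht
    obtain ⟨k, hk⟩ := exists_lift_mono hm t.hom (fun x => by
      have e : hom π (hom t.hom x - hom Q.s (hom T.f x)) = 0 := by
        rw [map_sub, ← hom_comp, ht', hom_comp, hom_comp, sub_self]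
      obtain ⟨p, -, hp⟩ := (hN _).1 ((hπN _).1 e)
      exact ⟨p + hom P.s (hom T.f x), by rw [map_add, hp, point_hom_s, sub_add_cancel]⟩)
    exact ⟨⟨k, by rw [← m.comm_f, ← Category.assoc, hk, t.comm_f],
      by rw [← cancel_mono m.hom, Category.assoc, hk, t.comm_s, m.comm_s]⟩, Pt.hom_ext hk⟩
  refine ⟨⟨R', g, w, KernelFork.IsLimit.ofι m w (fun t ht => (key t ht).choose)
    (fun t ht => (key t ht).choose_spec) (fun t ht k hk => Pt.hom_ext ?_)⟩⟩
  rw [← cancel_mono m.hom]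
  exact congrArg Pt.Hom.hom (hk.trans (key t ht).choose_spec.symm)

/-- The elements of the kernel that come from the domain of `m` are preserved and reflected by
base change. -/
theorem exists_baseChange_iff [HasPullbacks C] {Z Y : C} (w : Z ⟶ Y) {P Q : Pt Y} (m : P ⟶ Q)
    (x : carrier ((Pt.baseChange w).obj Q).X) :
    (∃ p, hom ((Pt.baseChange w).obj P).f p = 0 ∧ hom ((Pt.baseChange w).map m).hom p = x) ↔
      hom ((Pt.baseChange w).obj Q).f x = 0 ∧
        ∃ p, hom P.f p = 0 ∧ hom m.hom p = hom (Pt.baseChangeFst w Q) x := by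
  constructor
  · rintro ⟨p, hp, rfl⟩
    refine ⟨by rw [point_hom_f, hp], hom (Pt.baseChangeFst w P) p, ?_,
      (baseChangeFst_map w m p).symm⟩
    rw [← hom_comp, (Pt.isPullback_baseChange w P).w, hom_comp, hp, map_zero]
  · rintro ⟨hx, p, hp, h⟩
    obtain ⟨z, rfl, hz⟩ := exists_of_isPullback (Pt.isPullback_baseChange w P)
      (show hom P.f p = hom w 0 by rw [hp, map_zero])
    exact ⟨z, hz, jointlyInjective_of_isPullback (Pt.isPullback_baseChange w Q) _ _
      (by rw [baseChangeFst_map, h]) (by rw [point_hom_f, hz, hx])⟩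

/-! ### Higgins commutators on elements -/

theorem exists_imageSubobject_iff {X Y : C} (f : X ⟶ Y) [HasImage f] (y : carrier Y) :
    (∃ a, hom (imageSubobject f).arrow a = y) ↔ ∃ x, hom f x = y := by
  constructor
  · rintro ⟨a, rfl⟩
    obtain ⟨I, e, m, he, hes, hm⟩ := exists_image f
    have := mono_of_injective hm
    have hle : imageSubobject f ≤ Subobject.mk m :=
      imageSubobject_le f (e ≫ (Subobject.underlyingIso m).inv) (by simp [he])
    obtain ⟨x, hx⟩ := hes (hom ((Subobject.ofLE _ _ hle) ≫ (Subobject.underlyingIso m).hom) a)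
    refine ⟨x, ?_⟩
    rw [show hom f x = hom m (hom e x) by rw [← hom_comp, he], hx, ← hom_comp]
    simp
  · rintro ⟨x, rfl⟩
    exact ⟨hom (factorThruImageSubobject f) x, by rw [← hom_comp, imageSubobject_arrow_comp]⟩

/-- The elements of `[K, L]` are the values in `X` of the elements of `K + L` that vanish in
`K × L`. -/
theorem exists_higgins_iff [HasZeroMorphisms C] [SemiAbelian C] {X : C} (K L : Subobject X)
    (x : carrier X) : (∃ a, hom (higgins K L).arrow a = x) ↔
      ∃ t, hom (coprodToProd (K : C) (L : C)) t = 0 ∧ hom (coprod.desc K.arrow L.arrow) t = x := by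
  refine (exists_imageSubobject_iff _ x).trans ⟨?_, ?_⟩
  · rintro ⟨a, rfl⟩
    refine ⟨hom (coSmashι _ _) a, ?_, (hom_comp _ _ _).symm⟩
    have hw : coSmashι (K : C) (L : C) ≫ coprodToProd (K : C) (L : C) = 0 := kernel.condition _
    rw [← hom_comp, hw, hom_zero]
  · rintro ⟨t, ht, rfl⟩
    have h : ∃ a, hom (coSmashι (K : C) (L : C)) a = t := exists_kernel_mk ht
    obtain ⟨a, rfl⟩ := h
    exact ⟨a, hom_comp _ _ _⟩

theorem le_of_range_subset {X : C} {K L : Subobject X}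
    (h : ∀ a, ∃ b, hom L.arrow b = hom K.arrow a) : K ≤ L := by
  obtain ⟨k, hk⟩ := exists_lift_mono (injective_of_mono L.arrow) K.arrow h
  exact Subobject.le_of_comm k hk

/-- If products with `0` vanish, products of an element of `K` and an element of `L` belong to
the Higgins commutator `[K, L]`. -/
theorem exists_higgins_mul [HasZeroMorphisms C] [SemiAbelian C]
    (h₁ : ∀ (X : C) (x : carrier X), x * 0 = 0) (h₂ : ∀ (X : C) (x : carrier X), 0 * x = 0)
    {X : C} (K L : Subobject X) (x : carrier (K : C)) (y : carrier (L : C)) :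
    ∃ a, hom (higgins K L).arrow a = hom K.arrow x * hom L.arrow y := by
  refine (exists_higgins_iff K L _).2 ⟨hom coprod.inl x * hom coprod.inr y, ?_, ?_⟩
  · have hj : JointlyInjective (prod.fst : (K : C) ⨯ (L : C) ⟶ _) prod.snd :=
      jointlyInjective_of_cancel fun a b => Limits.prod.hom_ext
    refine hj _ _ ?_ ?_
    · rw [← hom_comp, map_mul, ← hom_comp, ← hom_comp, coprodToProd, prod.lift_fst,
        coprod.inl_desc, coprod.inr_desc, hom_zero, h₁, map_zero]
    · rw [← hom_comp, map_mul, ← hom_comp, ← hom_comp, coprodToProd, prod.lift_snd,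
        coprod.inl_desc, coprod.inr_desc, hom_zero, h₂, map_zero]
  · rw [map_mul, ← hom_comp, ← hom_comp, coprod.inl_desc, coprod.inr_desc]

/-! ### The lattice of equivalence relations -/

theorem exists_ideal_of_eqRel [HasFiniteLimits C] {X : C} (R : EqRel X) :
    ∃ N : AbIdeal (carrier X), ∀ x y,
      (∃ z, hom (R.1.arrow ≫ prod.fst) z = x ∧ hom (R.1.arrow ≫ prod.snd) z = y) ↔
        x - y ∈ N.toAddSubgroup := by
  obtain ⟨h⟩ := R.2.nonempty_equivalenceRelation
  exact exists_ideal_of_reflexive h.r h.reflexivity₁ h.reflexivity₂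

end AbMagmaVariety

namespace AbIdeal

variable {A : Type u} [AbMagma A]

theorem toAddSubgroup_injective :
    Function.Injective (AbIdeal.toAddSubgroup : AbIdeal A → AddSubgroup A) :=
  fun _ _ h => AbIdeal.ext (congrArg (fun S : AddSubgroup A => (S : Set A)) h)

instance : PartialOrder (AbIdeal A) := PartialOrder.lift _ toAddSubgroup_injective

instance : Lattice (AbIdeal A) where
  inf N M :=
    { N.toAddSubgroup ⊓ M.toAddSubgroup with
      mul_sub_mul_mem := fun h h' =>
        ⟨N.mul_sub_mul_mem h.1 h'.1, M.mul_sub_mul_mem h.2 h'.2⟩ }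
  sup N M :=
    { N.toAddSubgroup ⊔ M.toAddSubgroup with
      mul_sub_mul_mem := fun {a a' b b'} h h' => by
        obtain ⟨n, hn, m, hm, e⟩ := AddSubgroup.mem_sup.1 h
        obtain ⟨n', hn', m', hm', e'⟩ := AddSubgroup.mem_sup.1 h'
        -- pass from `a * b` to `a' * b'` through `(a' + m) * (b' + m')`
        refine AddSubgroup.mem_sup.2 ⟨a * b - (a' + m) * (b' + m'), N.mul_sub_mul_mem ?_ ?_,
          (a' + m) * (b' + m') - a' * b', M.mul_sub_mul_mem ?_ ?_, sub_add_sub_cancel _ _ _⟩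
        · rwa [show a - (a' + m) = n by rw [← sub_sub, ← e, add_sub_cancel_right]]
        · rwa [show b - (b' + m') = n' by rw [← sub_sub, ← e', add_sub_cancel_right]]
        · rwa [add_sub_cancel_left]
        · rwa [add_sub_cancel_left] }
  inf_le_left N M := (inf_le_left : N.toAddSubgroup ⊓ M.toAddSubgroup ≤ _)
  inf_le_right N M := (inf_le_right : N.toAddSubgroup ⊓ M.toAddSubgroup ≤ _)
  le_inf N M L h h' := (le_inf h h' : N.toAddSubgroup ≤ M.toAddSubgroup ⊓ L.toAddSubgroup)
  le_sup_left N M := (le_sup_left : _ ≤ N.toAddSubgroup ⊔ M.toAddSubgroup)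
  le_sup_right N M := (le_sup_right : _ ≤ N.toAddSubgroup ⊔ M.toAddSubgroup)
  sup_le N M L h h' := (sup_le h h' : N.toAddSubgroup ⊔ M.toAddSubgroup ≤ L.toAddSubgroup)

end AbIdeal

namespace AbMagmaVariety

variable {C : Type (u + 1)} [Category.{u} C] [AbMagmaVariety C]

/-- Equivalence relations on `X` correspond to ideals of `X`. -/
theorem nonempty_orderIso_ideal [HasFiniteLimits C] (X : C) :
    Nonempty (EqRel X ≃o AbIdeal (carrier X)) := by
  choose φ hφ using fun R : EqRel X => exists_ideal_of_eqRel R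
  have hj : ∀ R : EqRel X, JointlyInjective (R.1.arrow ≫ prod.fst) (R.1.arrow ≫ prod.snd) :=
    fun R => jointlyInjective_of_cancel fun a b h₁ h₂ => by
      rw [← cancel_mono R.1.arrow]
      exact Limits.prod.hom_ext (by simpa using h₁) (by simpa using h₂)
  have hle : ∀ {R S : EqRel X}, φ R ≤ φ S ↔ R ≤ S := by
    refine fun {R S} => ⟨fun h => ?_, fun h x hx => ?_⟩
    · obtain ⟨k, hk₁, hk₂⟩ := (hj S).exists_lift (R.1.arrow ≫ prod.fst) (R.1.arrow ≫ prod.snd)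
        fun t => (hφ S _ _).2 (h ((hφ R _ _).1 ⟨t, rfl, rfl⟩))
      exact Subobject.le_of_comm k (Limits.prod.hom_ext (by simpa using hk₁) (by simpa using hk₂))
    · rw [← sub_zero x] at hx ⊢
      obtain ⟨z, hz, hz'⟩ := (hφ R x 0).2 hx
      refine (hφ S x 0).1 ⟨hom (Subobject.ofLE R.1 S.1 h) z, ?_, ?_⟩
      · rw [← hom_comp, ← Category.assoc, Subobject.ofLE_arrow, hz]
      · rw [← hom_comp, ← Category.assoc, Subobject.ofLE_arrow, hz']
  have hsurj : Function.Surjective φ := by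
    intro N
    obtain ⟨Q, π, -, hN⟩ := exists_quotient N
    obtain ⟨P, a, b, hP, -, hs⟩ := exists_isPullback π π
    have hm : Mono (prod.lift a b) := ⟨fun s t h => hP.hom_ext
      (by simpa only [Category.assoc, prod.lift_fst] using congrArg (· ≫ prod.fst) h)
      (by simpa only [Category.assoc, prod.lift_snd] using congrArg (· ≫ prod.snd) h)⟩
    let i := Subobject.underlyingIso (prod.lift a b)
    have hi : (Subobject.mk (prod.lift a b)).arrow = i.hom ≫ prod.lift a b :=
      (Subobject.underlyingIso_hom_comp_eq_mk _).symm
    have he : IsEquivalenceRelation ((Subobject.mk (prod.lift a b)).arrow ≫ prod.fst)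
        ((Subobject.mk (prod.lift a b)).arrow ≫ prod.snd) :=
      isEquivalenceRelation_of_reflexive
        { right_cancellation := fun _ f g h₁ h₂ => by
            rw [← cancel_mono (Subobject.mk (prod.lift a b)).arrow]
            exact Limits.prod.hom_ext (by simpa using h₁) (by simpa using h₂)
          r := hP.lift (𝟙 X) (𝟙 X) rfl ≫ i.inv
          reflexivity₁ := by
            simp only [hi, Category.assoc, Iso.inv_hom_id_assoc, prod.lift_fst, hP.lift_fst]
          reflexivity₂ := by
            simp only [hi, Category.assoc, Iso.inv_hom_id_assoc, prod.lift_snd, hP.lift_snd] }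
    refine ⟨⟨_, he⟩, AbIdeal.toAddSubgroup_injective (AddSubgroup.ext fun x => ?_)⟩
    have h₀ := hφ ⟨_, he⟩ x 0
    rw [sub_zero] at h₀
    rw [← h₀, ← hN]
    simp only [hi, Category.assoc, prod.lift_fst, prod.lift_snd, hom_comp]
    constructor
    · rintro ⟨z, hz, hz'⟩
      rw [← hz, ← hom_comp, hP.w, hom_comp, hz', map_zero]
    · intro hx
      obtain ⟨p, rfl, hp⟩ := hs x 0 (by rw [hx, map_zero])
      obtain ⟨z, rfl⟩ := surjective_of_isIso i.hom p
      exact ⟨z, rfl, hp⟩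
  have hinj : Function.Injective φ := fun R S h => le_antisymm (hle.1 h.le) (hle.1 h.ge)
  exact ⟨⟨Equiv.ofBijective φ ⟨hinj, hsurj⟩, hle⟩⟩

/-- Distributivity is transported along an order isomorphism, without changing the order. -/
theorem exists_distribLattice_of_orderIso {α β : Type*} [PartialOrder α] [Lattice β] (e : α ≃o β)
    (h : ∀ a b c : β, a ⊓ (b ⊔ c) ≤ a ⊓ b ⊔ a ⊓ c) :
    ∃ L : DistribLattice α, ∀ a b, L.le a b ↔ a ≤ b := by
  let L : Lattice α :=
    { (inferInstance : PartialOrder α) with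
      sup := fun a b => e.symm (e a ⊔ e b)
      inf := fun a b => e.symm (e a ⊓ e b)
      le_sup_left := fun a b => by rw [e.le_symm_apply]; exact le_sup_left
      le_sup_right := fun a b => by rw [e.le_symm_apply]; exact le_sup_right
      sup_le := fun a b c h h' => by
        rw [e.symm_apply_le]; exact sup_le (e.monotone h) (e.monotone h')
      inf_le_left := fun a b => by rw [e.symm_apply_le]; exact inf_le_left
      inf_le_right := fun a b => by rw [e.symm_apply_le]; exact inf_le_right
      le_inf := fun a b c h h' => by
        rw [e.le_symm_apply]; exact le_inf (e.monotone h) (e.monotone h') }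
  refine ⟨DistribLattice.ofInfSupLe (α := α) fun a b c => ?_, fun _ _ => Iff.rfl⟩
  change e.symm (e a ⊓ e (e.symm (e b ⊔ e c))) ≤
    e.symm (e (e.symm (e a ⊓ e b)) ⊔ e (e.symm (e a ⊓ e c)))
  refine e.symm.monotone ?_
  rw [e.apply_symm_apply, e.apply_symm_apply, e.apply_symm_apply]
  exact h (e a) (e b) (e c)

/-- Since equivalence relations correspond to ideals, distributivity can be checked on ideals. -/
theorem arithmetical (h : ∀ (X : C) (L N M : AbIdeal (carrier X)),
    L ⊓ (N ⊔ M) ≤ L ⊓ N ⊔ L ⊓ M) : Arithmetical C where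
  __ := barrExact C
  maltsev _ _ h := isEquivalenceRelation_of_reflexive h.some
  distrib X := by
    have := hasFiniteLimits C
    obtain ⟨e⟩ := nonempty_orderIso_ideal X
    exact exists_distribLattice_of_orderIso e (h X)

/-! ### Varieties with a distributive or an idempotent multiplication -/

section Distributive

variable (hl : ∀ (X : C) (a b c : carrier X), a * (b + c) = a * b + a * c)
  (hr : ∀ (X : C) (a b c : carrier X), (a + b) * c = a * c + b * c)

include hl in
theorem mul_zero_of_distrib (X : C) (a : carrier X) : a * 0 = 0 := by
  have h := hl X a 0 0
  rwa [add_zero, left_eq_add] at h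

include hr in
theorem zero_mul_of_distrib (X : C) (a : carrier X) : 0 * a = 0 := by
  have h := hr X 0 0 a
  rwa [add_zero, left_eq_add] at h

include hl hr in
/-- Let `n` be in the image of the kernel of `P`. Every element of `Q` is the sum of an
element `q` of the kernel and an element `s y` of `Y`; products of `n` and `q` are controlled by the
base change, and products of `n` and `s y` can be computed in `P`. By distributivity this
suffices. -/
theorem stronglyProtomodular_of_distrib [HasPullbacks C] : StronglyProtomodular C := by
  refine ⟨protomodular C, fun {Z Y} w {P Q} m h => ?_⟩
  obtain ⟨hinj, N, hN⟩ := injective_and_exists_ideal_of_isNormalMono h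
  have hm := injective_of_injective_baseChange hinj
  have hl0 := mul_zero_of_distrib hl
  have hr0 := zero_mul_of_distrib hr
  let S : AddSubgroup (carrier Q.X) :=
    (hom P.f).toAddMonoidHom.ker.map (hom m.hom).toAddMonoidHom
  have hS : ∀ x, x ∈ S ↔ ∃ p, hom P.f p = 0 ∧ hom m.hom p = x := fun x => Iff.rfl
  -- products with elements of the kernel are controlled by the base change
  have hker : ∀ x q, x ∈ S → hom Q.f q = 0 → q * x ∈ S ∧ x * q ∈ S := by
    intro x q hx hq
    have hx' : hom Q.f x = 0 := by
      obtain ⟨p, hp, rfl⟩ := (hS x).1 hx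
      rw [point_hom_f, hp]
    obtain ⟨q', rfl, hq'⟩ := exists_of_isPullback (Pt.isPullback_baseChange w Q)
      (show hom Q.f q = hom w 0 by rw [hq, map_zero])
    obtain ⟨x', rfl, hx''⟩ := exists_of_isPullback (Pt.isPullback_baseChange w Q)
      (show hom Q.f x = hom w 0 by rw [hx', map_zero])
    have hxN : x' ∈ N.toAddSubgroup :=
      (hN x').2 ((exists_baseChange_iff w m x').2 ⟨hx'', (hS _).1 hx⟩)
    have h₁ := N.mul_sub_mul_zero_mem q' hxN
    have h₂ := N.mul_sub_zero_mul_mem q' hxN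
    rw [hl0, sub_zero] at h₁
    rw [hr0, sub_zero] at h₂
    have h₁' := ((exists_baseChange_iff w m _).1 ((hN _).1 h₁)).2
    have h₂' := ((exists_baseChange_iff w m _).1 ((hN _).1 h₂)).2
    rw [map_mul] at h₁' h₂'
    exact ⟨h₁', h₂'⟩
  -- products with elements of `Y` are images under `m`
  have hbase : ∀ x y, x ∈ S → hom Q.s y * x ∈ S ∧ x * hom Q.s y ∈ S := by
    intro x y hx
    obtain ⟨p, hp, rfl⟩ := (hS x).1 hx
    rw [← point_hom_s m]
    exact ⟨(hS _).2 ⟨hom P.s y * p, by rw [map_mul, hp, hl0], map_mul _ _ _⟩,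
      (hS _).2 ⟨p * hom P.s y, by rw [map_mul, hp, hr0], map_mul _ _ _⟩⟩
  have hmul : ∀ x q, x ∈ S → q * x ∈ S ∧ x * q ∈ S := by
    intro x q hx
    obtain ⟨h₁, h₂⟩ := hker x (q - hom Q.s (hom Q.f q)) hx
      (by rw [map_sub, point_section, sub_self])
    obtain ⟨h₃, h₄⟩ := hbase x (hom Q.f q) hx
    have e₁ := S.add_mem h₁ h₃
    have e₂ := S.add_mem h₂ h₄
    rw [← hr, sub_add_cancel] at e₁
    rw [← hl, sub_add_cancel] at e₂
    exact ⟨e₁, e₂⟩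
  refine isNormalMono_of_ideal hm
    { S with
      mul_sub_mul_mem := fun {a a' b b'} h h' => ?_ } hS
  have e := S.add_mem (hmul _ b h).2 (hmul _ a' h').1
  have e₁ : a * b = (a - a') * b + a' * b := by rw [← hr, sub_add_cancel]
  have e₂ : a' * b = a' * (b - b') + a' * b' := by rw [← hl, sub_add_cancel]
  rwa [show (a - a') * b + a' * (b - b') = a * b - a' * b' by
    rw [e₁, e₂, ← add_assoc, add_sub_cancel_right]] at e

include hl hr in
/-- If `u : K ⟶ Q` has an image with zero multiplication, then it vanishes on `[K, K]`: the map
`(a, b) ↦ u a + u b` is a morphism `K × K ⟶ Q`, and the codiagonal `K + K ⟶ K` followed by `u`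
factors through it. -/
theorem exists_of_higgins_of_mul_eq_zero [HasZeroMorphisms C] [SemiAbelian C] {X Q : C}
    {K : Subobject X} (u : (K : C) ⟶ Q) (hu : ∀ a b, hom u a * hom u b = 0)
    (a : carrier (higgins K K : C)) :
    ∃ z, hom u z = 0 ∧ hom K.arrow z = hom (higgins K K).arrow a := by
  obtain ⟨t, ht, hta⟩ := (exists_higgins_iff K K _).1 ⟨a, rfl⟩
  let v : (K : C) ⨯ (K : C) ⟶ Q := ofHom (.mk'
    (fun z => hom u (hom prod.fst z) + hom u (hom prod.snd z))
    (fun x y => by simp only [map_add]; exact add_add_add_comm _ _ _ _)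
    (fun x y => by simp only [map_mul, hl, hr, hu, add_zero]))
  have hv : ∀ {T : C} (z : T ⟶ (K : C) ⨯ (K : C)) (x : carrier T),
      hom (z ≫ v) x = hom (z ≫ prod.fst ≫ u) x + hom (z ≫ prod.snd ≫ u) x := fun z x => by
    simp only [v, hom_comp, hom_ofHom, AbMagmaHom.mk'_apply]
  have h : coprodToProd (K : C) (K : C) ≫ v = coprod.desc (𝟙 _) (𝟙 _) ≫ u := by
    refine coprod.hom_ext (hom_ext fun x => ?_) (hom_ext fun x => ?_) <;>
    · rw [← Category.assoc, hv, coprodToProd]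
      simp only [Category.assoc, prod.lift_fst_assoc, prod.lift_snd_assoc, coprod.inl_desc_assoc,
        coprod.inr_desc_assoc, zero_comp, hom_zero, Category.id_comp, add_zero, zero_add]
  refine ⟨hom (coprod.desc (𝟙 _) (𝟙 _)) t, ?_, ?_⟩
  · rw [← hom_comp, ← h, hom_comp, ht, map_zero]
  · rw [← hta, ← hom_comp]
    congr 2
    ext <;> simp

end Distributive

section Idempotent

variable (hi : ∀ (X : C) (a : carrier X), a * a = a)
  (hl : ∀ (X : C) (a : carrier X), a * 0 = 0) (hr : ∀ (X : C) (a : carrier X), 0 * a = 0)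

include hi hl hr

/-- Since `x = x * x`, every element of `K` is in `[K, K]`. -/
theorem wnh_of_mul_self [HasZeroMorphisms C] [SemiAbelian C] : WNH C := by
  intro X K hK
  have h : higgins K K = K := by
    refine le_antisymm (le_of_range_subset fun a => ?_) (le_of_range_subset fun a => ?_)
    · obtain ⟨t, -, ht⟩ := (exists_higgins_iff K K _).1 ⟨a, rfl⟩
      refine ⟨hom (coprod.desc (𝟙 _) (𝟙 _)) t, ?_⟩
      rw [← ht, ← hom_comp]
      congr 2
      ext <;> simp
    · obtain ⟨b, hb⟩ := exists_higgins_mul hl hr K K a a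
      exact ⟨b, by rw [hb, hi]⟩
  rwa [h]

/-- If `x = n + m` is in `L`, with `n` in `N` and `m` in `M`, then `x * n` is in `L` and in `N`,
and it is congruent to `x * x = x` modulo `M`. -/
theorem arithmetical_of_mul_self : Arithmetical C := by
  refine arithmetical fun X L N M x hx => ?_
  obtain ⟨hxL, hx⟩ := hx
  obtain ⟨n, hn, m, hm, e⟩ := AddSubgroup.mem_sup.1 hx
  have h₁ : x * n ∈ L.toAddSubgroup := by
    have := L.mul_sub_zero_mul_mem n hxL
    rwa [hr, sub_zero] at this
  have h₂ : x * n ∈ N.toAddSubgroup := by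
    have := N.mul_sub_mul_zero_mem x hn
    rwa [hl, sub_zero] at this
  have h₃ : x - x * n ∈ M.toAddSubgroup := by
    have := M.mul_sub_mul_mem (a := x) (a' := x) (b := x) (b' := n)
      (by rw [sub_self]; exact M.zero_mem) (by rwa [← e, add_sub_cancel_left])
    rwa [hi] at this
  exact AddSubgroup.mem_sup.2 ⟨x * n, ⟨h₁, h₂⟩, x - x * n, ⟨L.sub_mem hxL h₁, h₃⟩,
    add_sub_cancel _ _⟩

end Idempotent

end AbMagmaVariety

open AbMagmaVariety

/-! ### Abelian groups of exponent two with an idempotent commutative product -/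

instance (A : Type u) [ExpTwoAlgebra A] : AbMagma A where
  zero_mul_zero := ExpTwoAlgebra.mul_zero 0

instance : AbMagmaVariety ExpTwoAlgCat.{u} where
  carrier X := X.carrier
  str X := inferInstance
  hom f := .mk' f.toFun f.map_add f.map_mul
  ofHom f := ⟨f, map_zero f, map_neg f, map_add f, map_mul f⟩
  ofHom_hom _ := rfl
  hom_ofHom _ := rfl
  hom_id _ := rfl
  hom_comp _ _ _ := rfl
  exists_of_separated A _ h :=
    let _ : ExpTwoAlgebra A :=
      { add_self := fun x => h _ _ fun D f => by
          rw [map_add, map_zero]; exact ExpTwoAlgebra.add_self (f x)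
        mul_self := fun x => h _ _ fun D f => by
          rw [map_mul]; exact ExpTwoAlgebra.mul_self (f x)
        mul_comm := fun x y => h _ _ fun D f => by
          rw [map_mul, map_mul]; exact ExpTwoAlgebra.mul_comm (f x) (f y)
        mul_zero := fun x => h _ _ fun D f => by
          rw [map_mul, map_zero]; exact ExpTwoAlgebra.mul_zero (f x) }
    ⟨⟨A⟩, .mk' id (fun _ _ => rfl) (fun _ _ => rfl), Function.bijective_id⟩
  exists_of_surjective X A _ q h :=
    let _ : ExpTwoAlgebra A :=
      { add_self := h.forall.2 fun x => by
          rw [← map_add, ← map_zero q]; exact congrArg q (ExpTwoAlgebra.add_self x)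
        mul_self := h.forall.2 fun x => by
          rw [← map_mul]; exact congrArg q (ExpTwoAlgebra.mul_self x)
        mul_comm := h.forall₂.2 fun x y => by
          rw [← map_mul, ← map_mul]; exact congrArg q (ExpTwoAlgebra.mul_comm x y)
        mul_zero := h.forall.2 fun x => by
          rw [← map_zero q, ← map_mul]; exact congrArg q (ExpTwoAlgebra.mul_zero x) }
    ⟨⟨A⟩, .mk' id (fun _ _ => rfl) (fun _ _ => rfl), Function.bijective_id⟩

instance : SemiAbelian ExpTwoAlgCat.{u} := semiAbelian _

namespace ExpTwoAlgCat

theorem carrier_mul_self (X : ExpTwoAlgCat.{u}) (a : AbMagmaVariety.carrier X) : a * a = a :=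
  ExpTwoAlgebra.mul_self (A := X.carrier) a

theorem carrier_mul_zero (X : ExpTwoAlgCat.{u}) (a : AbMagmaVariety.carrier X) : a * 0 = 0 :=
  ExpTwoAlgebra.mul_zero (A := X.carrier) a

theorem carrier_zero_mul (X : ExpTwoAlgCat.{u}) (a : AbMagmaVariety.carrier X) : 0 * a = 0 :=
  (ExpTwoAlgebra.mul_comm (A := X.carrier) 0 a).trans (carrier_mul_zero X a)

/-- The group `𝔽₂³` with the product
`(a, b, c) * (a', b', c') = (a a', b b' + a b' c' + a' b c, c c')`. -/
def Twisted : Type u := ULift.{u} (ZMod 2 × ZMod 2 × ZMod 2)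

namespace Twisted

/-- The element with given coordinates. -/
def mk (a b c : ZMod 2) : Twisted.{u} := ⟨(a, b, c)⟩

/-- The first coordinate. -/
def a (x : Twisted.{u}) : ZMod 2 := x.down.1

/-- The second coordinate. -/
def b (x : Twisted.{u}) : ZMod 2 := x.down.2.1

/-- The third coordinate. -/
def c (x : Twisted.{u}) : ZMod 2 := x.down.2.2

theorem ext {x y : Twisted.{u}} (h₁ : x.a = y.a) (h₂ : x.b = y.b) (h₃ : x.c = y.c) : x = y :=
  ULift.ext _ _ (Prod.ext h₁ (Prod.ext h₂ h₃))

instance : AddCommGroup Twisted.{u} := inferInstanceAs (AddCommGroup (ULift _))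

instance : Mul Twisted.{u} :=
  ⟨fun x y => mk (x.a * y.a) (x.b * y.b + x.a * y.b * y.c + y.a * x.b * x.c) (x.c * y.c)⟩

theorem zero_a : (0 : Twisted.{u}).a = 0 := rfl
theorem zero_b : (0 : Twisted.{u}).b = 0 := rfl
theorem zero_c : (0 : Twisted.{u}).c = 0 := rfl
theorem mul_a (x y : Twisted.{u}) : (x * y).a = x.a * y.a := rfl
theorem mul_b (x y : Twisted.{u}) :
    (x * y).b = x.b * y.b + x.a * y.b * y.c + y.a * x.b * x.c := rfl
theorem mul_c (x y : Twisted.{u}) : (x * y).c = x.c * y.c := rfl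

theorem mk_zero_mul_mk_zero (r s r' s' : ZMod 2) :
    (mk r 0 s * mk r' 0 s' : Twisted.{u}) = mk (r * r') 0 (s * s') := by
  refine ext rfl ?_ rfl
  change 0 * 0 + r * 0 * s' + r' * 0 * s = 0
  ring

instance : ExpTwoAlgebra Twisted.{u} where
  add_self x := ext (CharTwo.add_self_eq_zero x.a) (CharTwo.add_self_eq_zero x.b)
    (CharTwo.add_self_eq_zero x.c)
  mul_self x := by
    have h : ∀ r : ZMod 2, r * r = r := by decide
    refine ext (h x.a) ?_ (h x.c)
    rw [mul_b, h, add_assoc, CharTwo.add_self_eq_zero, add_zero]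
  mul_comm x y := ext (mul_comm _ _)
    (by rw [mul_b, mul_b]; ring) (mul_comm _ _)
  mul_zero x := ext (by simp only [mul_a, zero_a, mul_zero])
    (by simp only [mul_b, zero_a, zero_b, zero_c, mul_zero, zero_mul, add_zero])
    (by simp only [mul_c, zero_c, mul_zero])

end Twisted

instance : ExpTwoAlgebra (ULift.{u} (ZMod 2)) where
  add_self x := ULift.ext _ _ (CharTwo.add_self_eq_zero x.down)
  mul_self x := ULift.ext _ _ ((by decide : ∀ r : ZMod 2, r * r = r) x.down)
  mul_comm := mul_comm
  mul_zero := mul_zero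

instance : ExpTwoAlgebra (ULift.{u} (ZMod 2 × ZMod 2)) where
  add_self x := ULift.ext _ _
    (Prod.ext (CharTwo.add_self_eq_zero x.down.1) (CharTwo.add_self_eq_zero x.down.2))
  mul_self x := ULift.ext _ _ ((by decide : ∀ r : ZMod 2 × ZMod 2, r * r = r) x.down)
  mul_comm := mul_comm
  mul_zero := mul_zero

/-- The field `𝔽₂` as an algebra. -/
def line : ExpTwoAlgCat.{u} := ⟨ULift.{u} (ZMod 2)⟩

/-- The point over `𝔽₂` given by the last coordinate `c` of the algebra `Twisted`. -/
def twistedPoint : Pt line.{u} where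
  X := ⟨Twisted.{u}⟩
  f := ofHom (.mk' (fun x : Twisted => (⟨x.c⟩ : ULift (ZMod 2))) (fun _ _ => rfl) (fun _ _ => rfl))
  s := ofHom (.mk' (fun y : ULift (ZMod 2) => Twisted.mk 0 0 y.down) (fun _ _ => rfl)
    (fun _ _ => (Twisted.mk_zero_mul_mk_zero 0 _ 0 _).symm))
  sf := rfl

/-- The point over `𝔽₂` given by the second projection of `𝔽₂²` with the coordinatewise
product. -/
def planePoint : Pt line.{u} where
  X := ⟨ULift.{u} (ZMod 2 × ZMod 2)⟩
  f := ofHom (.mk' (fun x : ULift (ZMod 2 × ZMod 2) => (⟨x.down.2⟩ : ULift (ZMod 2)))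
    (fun _ _ => rfl) (fun _ _ => rfl))
  s := ofHom (.mk' (fun y : ULift (ZMod 2) => (⟨(0, y.down)⟩ : ULift (ZMod 2 × ZMod 2)))
    (fun _ _ => rfl) (fun _ _ => ULift.ext _ _ (Prod.ext (mul_zero _).symm rfl)))
  sf := rfl

/-- The inclusion `(a, c) ↦ (a, 0, c)`. -/
def planeInclusion : planePoint.{u} ⟶ twistedPoint.{u} where
  hom := ofHom (.mk'
    (fun x : ULift (ZMod 2 × ZMod 2) => (Twisted.mk x.down.1 0 x.down.2 : Twisted))
    (fun _ _ => rfl)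
    (fun y z => (Twisted.mk_zero_mul_mk_zero y.down.1 y.down.2 z.down.1 z.down.2).symm))
  comm_f := rfl
  comm_s := rfl

theorem planeInclusion_injective : Function.Injective (hom planeInclusion.{u}.hom) := by
  intro x y h
  exact ULift.ext _ _ (Prod.ext (congrArg Twisted.a h) (congrArg Twisted.c h))

/-- The subgroup `b = c = 0` is not an ideal: it contains `(1, 0, 0)`, and
`(1, 0, 0) * (0, 1, 1) = (0, 1, 0)`. -/
theorem not_isNormalMono_planeInclusion : ¬ IsNormalMono planeInclusion.{u} := by
  intro h
  obtain ⟨-, N, hN⟩ := injective_and_exists_ideal_of_isNormalMono h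
  have h₁ : (Twisted.mk 1 0 0 : Twisted.{u}) ∈ N.toAddSubgroup :=
    (hN _).2 ⟨(⟨(1, 0)⟩ : ULift.{u} (ZMod 2 × ZMod 2)), rfl, rfl⟩
  have h₂ := N.mul_sub_zero_mul_mem (Twisted.mk 0 1 1 : Twisted.{u}) h₁
  obtain ⟨p, -, hp⟩ := (hN _).1 h₂
  have h₃ : (0 : ZMod 2) = 1 := congrArg Twisted.b hp
  exact absurd h₃ (by decide)

/-- On the kernel `c = 0` the product is coordinatewise, so `b = 0` defines an ideal of it. -/
theorem isNormalMono_baseChange_planeInclusion {Z : ExpTwoAlgCat.{u}}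
    (hZ : Subsingleton (AbMagmaVariety.carrier Z)) (w : Z ⟶ line) :
    IsNormalMono ((Pt.baseChange w).map planeInclusion) := by
  have hf : ∀ x, hom twistedPoint.f (hom (Pt.baseChangeFst w twistedPoint) x) = 0 := fun x => by
    rw [← AbMagmaVariety.hom_comp, (Pt.isPullback_baseChange w twistedPoint).w,
      AbMagmaVariety.hom_comp,
      Subsingleton.elim (hom _ x) 0, map_zero]
  have hc : ∀ x, Twisted.c (hom (Pt.baseChangeFst w twistedPoint) x) = 0 := fun x =>
    congrArg ULift.down (hf x)
  let β : AbMagmaHom (AbMagmaVariety.carrier ((Pt.baseChange w).obj twistedPoint).X)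
      (ULift.{u} (ZMod 2)) := .mk'
    (fun x => ⟨Twisted.b (hom (Pt.baseChangeFst w twistedPoint) x)⟩)
    (fun x y => by rw [map_add]; rfl)
    (fun x y => ULift.ext _ _ (by
      rw [map_mul]
      refine (Twisted.mul_b _ _).trans ?_
      rw [hc, hc, mul_zero, mul_zero, add_zero, add_zero]
      rfl))
  have hinj : Function.Injective (hom ((Pt.baseChange w).map planeInclusion).hom) := by
    intro x y h
    refine jointlyInjective_of_isPullback (Pt.isPullback_baseChange w planePoint) _ _
      (planeInclusion_injective ?_) (Subsingleton.elim _ _)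
    rw [← baseChangeFst_map, h, baseChangeFst_map]
  refine isNormalMono_of_ideal hinj (.ker β) fun x => ?_
  rw [exists_baseChange_iff, AbIdeal.mem_ker]
  constructor
  · intro h
    refine ⟨Subsingleton.elim _ _,
      (⟨(Twisted.a (hom (Pt.baseChangeFst w twistedPoint) x), 0)⟩ : ULift.{u} (ZMod 2 × ZMod 2)),
      rfl, Twisted.ext rfl (congrArg ULift.down h).symm (hc x).symm⟩
  · rintro ⟨-, p, -, hp⟩
    exact ULift.ext _ _ (congrArg Twisted.b hp).symm

theorem wnh : WNH ExpTwoAlgCat.{u} :=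
  wnh_of_mul_self carrier_mul_self carrier_mul_zero carrier_zero_mul

theorem arithmetical : Arithmetical ExpTwoAlgCat.{u} :=
  arithmetical_of_mul_self carrier_mul_self carrier_mul_zero carrier_zero_mul

theorem not_stronglyProtomodular : ¬ StronglyProtomodular ExpTwoAlgCat.{u} := by
  rintro ⟨-, h⟩
  obtain ⟨Z, hZ, hZ'⟩ := exists_isZero ExpTwoAlgCat.{u}
  exact not_isNormalMono_planeInclusion
    (h (hZ'.to_ line) planeInclusion (isNormalMono_baseChange_planeInclusion hZ _))

end ExpTwoAlgCat

/-! ### Non-associative rings -/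

instance (A : Type u) [NonUnitalNonAssocRing A] : AbMagma A where
  zero_mul_zero := mul_zero 0

instance : AbMagmaVariety NonAssocRngCat.{u} where
  carrier X := X.carrier
  str X := inferInstance
  hom f := .mk' f.hom (map_add f.hom) (map_mul f.hom)
  ofHom f := ⟨{ f with map_zero' := map_zero f, map_mul' := map_mul f }⟩
  ofHom_hom _ := rfl
  hom_ofHom _ := rfl
  hom_id _ := rfl
  hom_comp _ _ _ := rfl
  exists_of_separated A _ h :=
    let _ : NonUnitalNonAssocRing A :=
      { left_distrib := fun x y z => h _ _ fun D f => by
          simp only [map_mul, map_add]; exact mul_add (R := D.carrier) _ _ _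
        right_distrib := fun x y z => h _ _ fun D f => by
          simp only [map_mul, map_add]; exact add_mul (R := D.carrier) _ _ _
        zero_mul := fun x => h _ _ fun D f => by
          rw [map_mul, map_zero]; exact zero_mul (M₀ := D.carrier) _
        mul_zero := fun x => h _ _ fun D f => by
          rw [map_mul, map_zero]; exact mul_zero (M₀ := D.carrier) _ }
    ⟨⟨A⟩, .mk' id (fun _ _ => rfl) (fun _ _ => rfl), Function.bijective_id⟩
  exists_of_surjective X A _ q h :=
    let _ : NonUnitalNonAssocRing A :=
      { left_distrib := h.forall₃.2 fun x y z => by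
          simp only [← map_mul, ← map_add]; exact congrArg q (mul_add (R := X.carrier) x y z)
        right_distrib := h.forall₃.2 fun x y z => by
          simp only [← map_mul, ← map_add]; exact congrArg q (add_mul (R := X.carrier) x y z)
        zero_mul := h.forall.2 fun x => by
          rw [← map_zero q, ← map_mul]; exact congrArg q (zero_mul (M₀ := X.carrier) x)
        mul_zero := h.forall.2 fun x => by
          rw [← map_zero q, ← map_mul]; exact congrArg q (mul_zero (M₀ := X.carrier) x) }
    ⟨⟨A⟩, .mk' id (fun _ _ => rfl) (fun _ _ => rfl), Function.bijective_id⟩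

instance : SemiAbelian NonAssocRngCat.{u} := semiAbelian _

namespace NonAssocRngCat

theorem carrier_mul_add (X : NonAssocRngCat.{u}) (a b c : AbMagmaVariety.carrier X) :
    a * (b + c) = a * b + a * c :=
  mul_add (R := X.carrier) a b c

theorem carrier_add_mul (X : NonAssocRngCat.{u}) (a b c : AbMagmaVariety.carrier X) :
    (a + b) * c = a * c + b * c :=
  add_mul (R := X.carrier) a b c

theorem stronglyProtomodular : StronglyProtomodular NonAssocRngCat.{u} :=
  stronglyProtomodular_of_distrib carrier_mul_add carrier_add_mul

/-- The group `ℤ³` with the product `(a, b, c) * (a', b', c') = (c b', a a', 0)`. -/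
def Twisted : Type u := ULift.{u} (ℤ × ℤ × ℤ)

/-- The group `ℤ²` with the product `(a, b) * (a', b') = (0, a a')`. -/
def Square : Type u := ULift.{u} (ℤ × ℤ)

/-- The group `ℤ` with the zero product. -/
def Null : Type u := ULift.{u} ℤ

instance : AddCommGroup Twisted.{u} := inferInstanceAs (AddCommGroup (ULift _))

instance : AddCommGroup Square.{u} := inferInstanceAs (AddCommGroup (ULift _))

instance : AddCommGroup Null.{u} := inferInstanceAs (AddCommGroup (ULift _))

instance : NonUnitalNonAssocRing Twisted.{u} where
  mul x y := ⟨(x.down.2.2 * y.down.2.1, x.down.1 * y.down.1, 0)⟩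
  left_distrib _ _ _ := ULift.ext _ _
    (Prod.ext (mul_add _ _ _) (Prod.ext (mul_add _ _ _) (add_zero 0).symm))
  right_distrib _ _ _ := ULift.ext _ _
    (Prod.ext (add_mul _ _ _) (Prod.ext (add_mul _ _ _) (add_zero 0).symm))
  zero_mul _ := ULift.ext _ _ (Prod.ext (zero_mul _) (Prod.ext (zero_mul _) rfl))
  mul_zero _ := ULift.ext _ _ (Prod.ext (mul_zero _) (Prod.ext (mul_zero _) rfl))

instance : NonUnitalNonAssocRing Square.{u} where
  mul x y := ⟨(0, x.down.1 * y.down.1)⟩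
  left_distrib _ _ _ := ULift.ext _ _ (Prod.ext (add_zero 0).symm (mul_add _ _ _))
  right_distrib _ _ _ := ULift.ext _ _ (Prod.ext (add_zero 0).symm (add_mul _ _ _))
  zero_mul _ := ULift.ext _ _ (Prod.ext rfl (zero_mul _))
  mul_zero _ := ULift.ext _ _ (Prod.ext rfl (mul_zero _))

instance : NonUnitalNonAssocRing Null.{u} where
  mul _ _ := 0
  left_distrib _ _ _ := (add_zero 0).symm
  right_distrib _ _ _ := (add_zero 0).symm
  zero_mul _ := rfl
  mul_zero _ := rfl

/-- The inclusion `(a, b) ↦ (a, b, 0)` of an ideal. -/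
def squareInclusion : (⟨Square.{u}⟩ : NonAssocRngCat.{u}) ⟶ ⟨Twisted.{u}⟩ :=
  ofHom (.mk' (fun x : Square => (⟨(x.down.1, x.down.2, 0)⟩ : Twisted)) (fun _ _ => rfl)
    (fun _ _ => ULift.ext _ _ (Prod.ext (zero_mul _).symm rfl)))

/-- The projection `(a, b, c) ↦ c`, with kernel `c = 0`. -/
def twistedToNull : (⟨Twisted.{u}⟩ : NonAssocRngCat.{u}) ⟶ ⟨Null.{u}⟩ :=
  ofHom (.mk' (fun x : Twisted => (⟨x.down.2.2⟩ : Null)) (fun _ _ => rfl) (fun _ _ => rfl))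

/-- The projection `(a, b) ↦ a`. -/
def squareToNull : (⟨Square.{u}⟩ : NonAssocRngCat.{u}) ⟶ ⟨Null.{u}⟩ :=
  ofHom (.mk' (fun x : Square => (⟨x.down.1⟩ : Null)) (fun _ _ => rfl) (fun _ _ => rfl))

theorem squareInclusion_injective : Function.Injective (hom squareInclusion.{u}) := fun _ _ h =>
  ULift.ext _ _ (Prod.ext (congrArg (fun z : Twisted => z.down.1) h)
    (congrArg (fun z : Twisted => z.down.2.1) h))

theorem twistedToNull_eq_zero_iff (x : Twisted.{u}) :
    hom twistedToNull x = 0 ↔ ∃ a, hom squareInclusion a = x := by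
  constructor
  · intro h
    have h' : x.down.2.2 = 0 := congrArg ULift.down h
    exact ⟨(⟨(x.down.1, x.down.2.1)⟩ : Square),
      ULift.ext _ _ (Prod.ext rfl (Prod.ext rfl h'.symm))⟩
  · rintro ⟨a, rfl⟩
    rfl

/-- For the ideal `K` of elements `(a, b, 0)`, the commutator `[K, K]` contains
`(0, 1, 0) = (1, 0, 0) * (1, 0, 0)`, and all its elements have first coordinate `0`. It is not
an ideal, because `(0, 0, 1) * (0, 1, 0) = (1, 0, 0)`. -/
theorem not_wnh : ¬ WNH NonAssocRngCat.{u} := by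
  intro h
  have hmono := mono_of_injective squareInclusion_injective.{u}
  let K := Subobject.mk squareInclusion.{u}
  let i := Subobject.underlyingIso squareInclusion.{u}
  have hi : K.arrow = i.hom ≫ squareInclusion :=
    (Subobject.underlyingIso_hom_comp_eq_mk _).symm
  have hK : IsNormalMono K.arrow := by
    refine isNormalMono_of_ker (injective_of_mono K.arrow) twistedToNull fun x => ?_
    rw [twistedToNull_eq_zero_iff, hi]
    constructor
    · rintro ⟨a, rfl⟩
      obtain ⟨b, rfl⟩ := surjective_of_isIso i.hom a
      exact ⟨b, AbMagmaVariety.hom_comp _ _ _⟩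
    · rintro ⟨b, rfl⟩
      exact ⟨hom i.hom b, (AbMagmaVariety.hom_comp _ _ _).symm⟩
  obtain ⟨N, hN⟩ := exists_ideal_of_isNormalMono (h K hK)
  obtain ⟨e, he⟩ := surjective_of_isIso i.hom (⟨(1, 0)⟩ : Square)
  have hKe : hom K.arrow e = (⟨(1, 0, 0)⟩ : Twisted) := by
    rw [hi, AbMagmaVariety.hom_comp, he]; rfl
  obtain ⟨b, hb⟩ := exists_higgins_mul (mul_zero_of_distrib carrier_mul_add)
    (zero_mul_of_distrib carrier_add_mul) K K e e
  rw [hKe] at hb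
  have h₁ := N.mul_sub_mul_zero_mem (⟨(0, 0, 1)⟩ : Twisted) ((hN _).2 ⟨b, hb⟩)
  obtain ⟨a, ha⟩ := (hN _).1 h₁
  obtain ⟨z, hz, hza⟩ := exists_of_higgins_of_mul_eq_zero carrier_mul_add carrier_add_mul
    (i.hom ≫ squareToNull) (fun _ _ => rfl) a
  rw [ha, hi, AbMagmaVariety.hom_comp] at hza
  have h₂ : (hom i.hom z : Square).down.1 = 1 := congrArg (fun z : Twisted => z.down.1) hza
  rw [AbMagmaVariety.hom_comp] at hz
  have h₃ : (hom i.hom z : Square).down.1 = 0 := congrArg ULift.down hz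
  exact absurd (h₂.symm.trans h₃) one_ne_zero

end NonAssocRngCat

end SemiAb

theorem mainTheorem8 :
    -- neither condition implies the other for semi-abelian categories
    (¬ ∀ (C : Type (u + 1)) [Category.{u} C] [HasZeroMorphisms C] [SemiAb.SemiAbelian C],
        SemiAb.WNH C → SemiAb.StronglyProtomodular C) ∧
    (¬ ∀ (C : Type (u + 1)) [Category.{u} C] [HasZeroMorphisms C] [SemiAb.SemiAbelian C],
        SemiAb.StronglyProtomodular C → SemiAb.WNH C) ∧
    -- the first example
    (∃ _ : SemiAb.SemiAbelian SemiAb.ExpTwoAlgCat.{u},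
      SemiAb.Arithmetical SemiAb.ExpTwoAlgCat.{u} ∧
      SemiAb.WNH SemiAb.ExpTwoAlgCat.{u} ∧
      ¬ SemiAb.StronglyProtomodular SemiAb.ExpTwoAlgCat.{u}) ∧
    -- the second example
    (∃ _ : SemiAb.SemiAbelian SemiAb.NonAssocRngCat.{u},
      SemiAb.StronglyProtomodular SemiAb.NonAssocRngCat.{u} ∧
      ¬ SemiAb.WNH SemiAb.NonAssocRngCat.{u}) := by
  exact ⟨fun h => SemiAb.ExpTwoAlgCat.not_stronglyProtomodular (h _ SemiAb.ExpTwoAlgCat.wnh),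
    fun h => SemiAb.NonAssocRngCat.not_wnh (h _ SemiAb.NonAssocRngCat.stronglyProtomodular),
    ⟨inferInstance, SemiAb.ExpTwoAlgCat.arithmetical, SemiAb.ExpTwoAlgCat.wnh,
      SemiAb.ExpTwoAlgCat.not_stronglyProtomodular⟩,
    ⟨inferInstance, SemiAb.NonAssocRngCat.stronglyProtomodular, SemiAb.NonAssocRngCat.not_wnh⟩⟩
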